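/- Let $\mathbb{K}$ be a field of characteristic zero, and let $\mathbb{K}[x,\partial]=\mathbb{K}\langle x,\partial;\ \partial x=x\partial+1\rangle$ be the algebra of linear differential operators with polynomial coefficients. For natural numbers $d,r$ let $\mathbb{K}[x,\partial]_{d,r}$ be the set of operators $\sum_{i<d,\,j<r}L_{i,j}\,x^i\partial^j$ with $L_{i,j}\in\mathbb{K}$; such an operator is represented by the coefficients $L_{i,j}$ of this canonical form. Costs are numbers of field operations ($+,-,\times,/$) in $\mathbb{K}$, in the straight-line program model: an algorithm for inputs of a given size is a finite sequence of field operations, each applied to inputs, constants of $\mathbb{K}$ or earlier results, in which no division by zero occurs on any input. Let $\mathsf{M}:\mathbb{N}\to\mathbb{R}$ be such that, for every $d\geqslant 1$, polynomials of degree less than $d$ over $\mathbb{K}$ can be multiplied in at most $\mathsf{M}(d)$ operations, and such that $\mathsf{M}(d)/d$ is a (weakly) increasing function of $d\geqslant 1$. Let $\omega$ be a feasible exponent for matrix multiplication over $\mathbb{K}$, that is, a real number with $2\leqslant\omega\leqslant 3$ such that two $n\times n$ matrices over $\mathbb{K}$ can be multiplied in $\mathcal{O}(n^{\omega})$ operations.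 Then the product $KL$ of operators $K,L\in\mathbb{K}[x,\partial]_{d,r}$ with $d>r$ can be computed using $$\mathcal{O}\bigl(r^{\omega-1}d+r\,\mathsf{M}(d)\log d\bigr)$$ operations in $\mathbb{K}$. That is, there is a constant $C$ such that for all natural numbers $d>r$ there is a straight-line program with at most $C\,(r^{\omega-1}d+r\,\mathsf{M}(d)\log d)$ operations that computes, from the coefficients of any $K,L\in\mathbb{K}[x,\partial]_{d,r}$, the coefficients of the canonical form of $KL$. -/

import Mathlib

/-! ### Straight-line programs over a field

The cost model of algebraic complexity theory: a program is a finite sequence of field operations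
`+`, `-`, `*`, `/`, each applied to inputs, constants of the field, or results of earlier
operations. Its cost is the number of these operations. -/

namespace SLP

/-- The four field operations. -/
inductive Op : Type
  | add | sub | mul | div

/-- An operand: an input, a constant of the field, or the result of the `n`-th operation
(counted from `0`). -/
inductive Operand (F : Type*) (ι : Type*)
  | input (i : ι)
  | const (c : F)
  | reg (n : ℕ)

/-- One instruction: an operation and its two operands. -/
structure Instr (F : Type*) (ι : Type*) where
  op : Op
  fst : Operand F ι
  snd : Operand F ι

/-- A straight-line program over `F` with inputs indexed by `ι` and outputs indexed by `o`. -/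
structure Program (F : Type*) (ι o : Type*) where
  instrs : List (Instr F ι)
  out : o → Operand F ι

/-- The cost of a program: the number of field operations that it performs. -/
def Program.cost {F ι o : Type*} (P : Program F ι o) : ℕ := P.instrs.length

/-- The value of an operand, given the inputs `x` and the list `m` of the results so far;
a reference to a result that is not yet available has no value. -/
def Operand.val {F ι : Type*} (x : ι → F) (m : List F) : Operand F ι → Option F
  | .input i => some (x i)
  | .const c => some c
  | .reg n => m[n]?

open Classical in
/-- The result of a field operation; a division by zero has no result. -/
noncomputable def Op.apply {F : Type*} [Field F] : Op → F → F → Option F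
  | .add, a, b => some (a + b)
  | .sub, a, b => some (a - b)
  | .mul, a, b => some (a * b)
  | .div, a, b => if b = 0 then none else some (a / b)

/-- The result of one instruction. -/
noncomputable def Instr.exec {F ι : Type*} [Field F] (x : ι → F) (m : List F) (I : Instr F ι) :
    Option F :=
  (I.fst.val x m).bind fun a => (I.snd.val x m).bind fun b => I.op.apply a b

/-- Run a list of instructions on the inputs `x`, starting from the list `m` of earlier results.
Each new result is appended at the end. The run fails as soon as one instruction fails. -/
noncomputable def run {F ι : Type*} [Field F] (x : ι → F) :
    List (Instr F ι) → List F → Option (List F)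
  | [], m => some m
  | I :: Is, m => (I.exec x m).bind fun v => run x Is (m ++ [v])

/-- On the inputs `x`, the program `P` runs without failure and returns the outputs `y`. -/
def Program.Returns {F ι o : Type*} [Field F] (P : Program F ι o) (x : ι → F) (y : o → F) : Prop :=
  ∃ m, run x P.instrs [] = some m ∧ ∀ j, (P.out j).val x m = some (y j)

end SLP

/-! ### Polynomial and matrix multiplication -/

/-- The polynomial of degree less than `d` with the coefficients `a`. -/
noncomputable def polyOfCoeffs {F : Type*} [Field F] {d : ℕ} (a : Fin d → F) : Polynomial F :=
  ∑ i : Fin d, Polynomial.C (a i) * Polynomial.X ^ (i : ℕ)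

/-- The program `P` multiplies polynomials of degree less than `d` over `F`: from the coefficients
of any two of them, it computes the coefficients of their product. -/
def MultipliesPolys {F : Type*} [Field F] (d : ℕ)
    (P : SLP.Program F (Fin d ⊕ Fin d) (Fin (2 * d))) : Prop :=
  ∀ a b : Fin d → F, ∃ c : Fin (2 * d) → F,
    P.Returns (Sum.elim a b) c ∧ polyOfCoeffs c = polyOfCoeffs a * polyOfCoeffs b

/-- `M` bounds the cost of polynomial multiplication over `F`: for every `d ≥ 1`, polynomials of
degree less than `d` can be multiplied within `M d` field operations. -/
def IsPolyMulTime (F : Type*) [Field F] (M : ℕ → ℝ) : Prop :=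
  ∀ d : ℕ, 1 ≤ d → ∃ P : SLP.Program F (Fin d ⊕ Fin d) (Fin (2 * d)),
    (P.cost : ℝ) ≤ M d ∧ MultipliesPolys d P

/-- The program `P` multiplies `n × n` matrices over `F`. -/
def MultipliesMatrices {F : Type*} [Field F] (n : ℕ)
    (P : SLP.Program F ((Fin n × Fin n) ⊕ (Fin n × Fin n)) (Fin n × Fin n)) : Prop :=
  ∀ A B : Matrix (Fin n) (Fin n) F,
    P.Returns (Sum.elim (fun p => A p.1 p.2) (fun p => B p.1 p.2)) (fun p => (A * B) p.1 p.2)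

/-- `ω` is a feasible exponent for matrix multiplication over `F`: a real number with `2 ≤ ω ≤ 3`
such that `n × n` matrices can be multiplied within `O(n ^ ω)` field operations. -/
def IsFeasibleExponent (F : Type*) [Field F] (ω : ℝ) : Prop :=
  2 ≤ ω ∧ ω ≤ 3 ∧ ∃ c : ℝ, ∀ n : ℕ, 1 ≤ n →
    ∃ P : SLP.Program F ((Fin n × Fin n) ⊕ (Fin n × Fin n)) (Fin n × Fin n),
      (P.cost : ℝ) ≤ c * (n : ℝ) ^ ω ∧ MultipliesMatrices n P

/-! ### Linear differential operators with polynomial coefficients -/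

namespace DiffOp

/-- The two generators `x` and `∂`. -/
inductive Gen : Type
  | x | d

/-- The commutation rule `∂ x = x ∂ + 1`. -/
inductive Rel (F : Type*) [Field F] : FreeAlgebra F Gen → FreeAlgebra F Gen → Prop
  | comm : Rel F (FreeAlgebra.ι F Gen.d * FreeAlgebra.ι F Gen.x)
      (FreeAlgebra.ι F Gen.x * FreeAlgebra.ι F Gen.d + 1)

end DiffOp

/-- The algebra `F[x, ∂] = F⟨x, ∂ ; ∂ x = x ∂ + 1⟩` of linear differential operators. -/
abbrev DiffOp (F : Type*) [Field F] : Type _ := RingQuot (DiffOp.Rel F)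

namespace DiffOp

/-- The generator `x`. -/
noncomputable def x (F : Type*) [Field F] : DiffOp F :=
  RingQuot.mkAlgHom F (Rel F) (FreeAlgebra.ι F Gen.x)

/-- The generator `∂`. -/
noncomputable def d (F : Type*) [Field F] : DiffOp F :=
  RingQuot.mkAlgHom F (Rel F) (FreeAlgebra.ι F Gen.d)

/-- The operator `∑ a (i, j) x ^ i ∂ ^ j` of bidegree less than `(m, n)` in `(x, ∂)`, given by the
coefficients of its canonical form. -/
noncomputable def ofCoeffs {F : Type*} [Field F] {m n : ℕ} (a : Fin m × Fin n → F) : DiffOp F :=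
  ∑ p : Fin m × Fin n, a p • (x F ^ (p.1 : ℕ) * d F ^ (p.2 : ℕ))

end DiffOp

/-- The program `P` multiplies operators of bidegree less than `(d, r)` in `(x, ∂)`: from the
coefficients of the canonical forms of any two of them, it computes the coefficients of the
canonical form of their product. -/
def MultipliesDiffOps {F : Type*} [Field F] (d r : ℕ)
    (P : SLP.Program F ((Fin d × Fin r) ⊕ (Fin d × Fin r)) (Fin (2 * d) × Fin (2 * r))) : Prop :=
  ∀ a b : Fin d × Fin r → F, ∃ c : Fin (2 * d) × Fin (2 * r) → F,
    P.Returns (Sum.elim a b) c ∧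
      DiffOp.ofCoeffs c = DiffOp.ofCoeffs a * DiffOp.ofCoeffs b

/-!
# Multiplication of linear differential operators by evaluation and interpolation

**The algebra.** For an operator `P` in canonical form, reduction of `∂ ^ k P` modulo the right
ideal `(x - α) F[x, ∂]` evaluates the coefficients of its canonical form at `x = α`. The quotient by
this ideal is the right module `F[∂]`, on which `P` acts by the matrix whose entry `(k, m)` is the
coefficient of `∂ ^ m` in `∂ ^ k P`, evaluated at `α`. Since `∂ ^ k (K L) = (∂ ^ k K) L`, the matrix
of `K L` is the product of those of `K` and `L` (`DiffOp.nabla_pow_opMul`). By the binomial theorem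
for the commuting maps "differentiate the coefficients" and "multiply by the variable `∂`", the
first `s` rows of the matrix of `P` and the Taylor coefficients up to order `s` at `α` of the
coefficients of `P` determine each other, and after a shift of the rows either passage is a product
with one fixed matrix (`DiffOp.coeff_nabla_pow`, `DiffOp.iterate_derivative_coeff`); going back
divides by factorials, whence characteristic zero. So `O(1)` products of matrices of size `O(r)`
lead from `K` and `L` modulo `(x - α) ^ (2 r)` to `K L` modulo `(x - α) ^ r`
(`SLP.computes_opMul_modByMonic`).

**The algorithm.** Take `2 ^ h ≈ 2 d / r` points, so that the coefficients of `K L`, of degree less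
than `2 d`, are determined by their remainders modulo the `(x - α) ^ r`. The matrix products cost
`O((d / r) r ^ ω)`. Remainders are computed and recombined along a binary tree
(`SLP.computes_remainders`, `SLP.computes_of_remainders`). The moduli do not depend on the input, so
the inverses needed for fast division and for Chinese remaindering are constants of the program, and
each node costs a bounded number of polynomial products (`SLP.computes_modByMonic`,
`SLP.computes_of_modByMonic`). As `M(m) ≤ (m / d) M(d)` for `m ≤ d`, each of the `O(log d)` levels
costs `O(M(d))` for each of the `O(r)` polynomials.

**The cost model.** Computed values are treated as functions on the space `Ω` of inputs, and
`SLP.Computes S c T` says that all functions in the set `T` can be computed from those in `S` within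
`c` operations. Polynomials and operators then have coefficients in the ring `Ω → F`; programs are
turned into statements of this kind by `SLP.Program.computes`, and back by
`SLP.Computes.exists_program`.
-/

/-! ### Sets of functions computed by straight-line programs -/

namespace SLP

variable {F Ω ι o : Type*}

/-- The functions on the input space `Ω` that may be used as operands once the functions in `S` are
known: those in `S` and the constants. -/
def avail (S : Set (Ω → F)) : Set (Ω → F) :=
  S ∪ Set.range (Function.const Ω)

theorem mem_avail_of_mem {S : Set (Ω → F)} {f : Ω → F} (h : f ∈ S) : f ∈ avail S := Or.inl h

theorem avail_mono {S S' : Set (Ω → F)} (h : S ⊆ S') : avail S ⊆ avail S' :=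
  Set.union_subset_union_left _ h

theorem avail_subset {S S' : Set (Ω → F)} (h : S ⊆ avail S') : avail S ⊆ avail S' :=
  Set.union_subset h Set.subset_union_right

/-- An operand whose value is defined for all inputs is available. Inputs must exist, as a dangling
reference to a register is detected only by running the program. -/
theorem Operand.mem_avail [Nonempty Ω] {S : Set (Ω → F)} {u : ι → Ω → F} {m : List (Ω → F)}
    (hu : ∀ i, u i ∈ avail S) (hm : ∀ f ∈ m, f ∈ avail S) (p : Operand F ι) {f : Ω → F}
    (hf : ∀ ξ, p.val (fun i => u i ξ) (m.map fun g => g ξ) = some (f ξ)) : f ∈ avail S := by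
  cases p with
  | input i =>
    have : f = u i := funext fun ξ => by simpa [Operand.val] using (hf ξ).symm
    exact this ▸ hu i
  | const c =>
    have : f = Function.const Ω c := funext fun ξ => by simpa [Operand.val] using (hf ξ).symm
    exact this ▸ Or.inr ⟨c, rfl⟩
  | reg n =>
    simp only [Operand.val, List.getElem?_map, Option.map_eq_some_iff] at hf
    obtain ⟨g, hg, -⟩ := hf (Classical.arbitrary Ω)
    have : f = g := funext fun ξ => by
      obtain ⟨g', hg', h⟩ := hf ξ
      rw [hg] at hg'
      rw [← h, Option.some.inj hg']
    exact this ▸ hm g (List.mem_of_getElem? hg)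

theorem Operand.val_append {p : Operand F ι} {x : ι → F} {m : List F} {v : F}
    (h : p.val x m = some v) (l : List F) : p.val x (m ++ l) = some v := by
  cases p with
  | input i => exact h
  | const c => exact h
  | reg n =>
    simp only [Operand.val] at h ⊢
    rw [List.getElem?_append_left (List.getElem?_eq_some_iff.1 h).1, h]

variable [Field F]

theorem const_mem_avail (S : Set (Ω → F)) (c : F) : algebraMap F (Ω → F) c ∈ avail S :=
  Or.inr ⟨c, rfl⟩

theorem zero_mem_avail (S : Set (Ω → F)) : (0 : Ω → F) ∈ avail S := Or.inr ⟨0, rfl⟩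

/-- `Steps S n T`: from the functions in `S` (on a common input space `Ω`), all functions in `T` can
be computed by at most `n` field operations. Treating computed values as functions on `Ω`, collected
in sets, makes programs composable without any bookkeeping of registers. -/
inductive Steps : Set (Ω → F) → ℕ → Set (Ω → F) → Prop
  | done {S T : Set (Ω → F)} {n : ℕ} (h : T ⊆ avail S) : Steps S n T
  | step {S T : Set (Ω → F)} {n : ℕ} (op : Op) {a b f : Ω → F} (ha : a ∈ avail S)
      (hb : b ∈ avail S) (hf : ∀ ξ, op.apply (a ξ) (b ξ) = some (f ξ))
      (h : Steps (insert f S) n T) : Steps S (n + 1) T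

/-- `Steps` with a real bound on the number of operations. -/
def Computes (S : Set (Ω → F)) (c : ℝ) (T : Set (Ω → F)) : Prop :=
  ∃ n : ℕ, (n : ℝ) ≤ c ∧ Steps S n T

theorem Steps.mono_source {S S' T : Set (Ω → F)} {n : ℕ} (h : Steps S n T) (hS : S ⊆ avail S') :
    Steps S' n T := by
  induction h generalizing S' with
  | done h => exact .done (h.trans (avail_subset hS))
  | step op ha hb hf _ ih =>
    refine .step op (avail_subset hS ha) (avail_subset hS hb) hf (ih ?_)
    exact Set.insert_subset (mem_avail_of_mem (Set.mem_insert _ _))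
      (hS.trans (avail_mono (Set.subset_insert _ _)))

theorem Steps.mono_nat {S T : Set (Ω → F)} {n n' : ℕ} (h : Steps S n T) (hn : n ≤ n') :
    Steps S n' T := by
  induction h generalizing n' with
  | done h => exact .done h
  | step op ha hb hf _ ih =>
    obtain ⟨k, rfl⟩ : ∃ k, n' = k + 1 := ⟨n' - 1, by omega⟩
    exact .step op ha hb hf (ih (by omega))

/-- Sequential composition. -/
theorem Steps.bind {S T U : Set (Ω → F)} {n n' : ℕ} (h : Steps S n T)
    (hU : ∀ S', S ⊆ S' → T ⊆ avail S' → Steps S' n' U) : Steps S (n + n') U := by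
  induction h with
  | done h => exact (hU _ subset_rfl h).mono_nat (by omega)
  | @step S T n op a b f ha hb hf h ih =>
    rw [Nat.add_right_comm]
    exact .step op ha hb hf (ih fun S' hS' => hU S' ((Set.subset_insert _ _).trans hS'))

theorem Steps.computes {S T : Set (Ω → F)} {n : ℕ} (h : Steps S n T) : Computes S n T :=
  ⟨n, le_rfl, h⟩

theorem Computes.of_subset {S T : Set (Ω → F)} {c : ℝ} (hc : 0 ≤ c) (h : T ⊆ avail S) :
    Computes S c T :=
  ⟨0, by simpa using hc, .done h⟩

theorem Computes.mono {S S' T T' : Set (Ω → F)} {c c' : ℝ} (h : Computes S c T)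
    (hS : S ⊆ avail S') (hc : c ≤ c') (hT : T' ⊆ avail T) : Computes S' c' T' := by
  obtain ⟨n, hn, h⟩ := h
  refine ⟨n, hn.trans hc, (?_ : Steps S n T').mono_source hS⟩
  exact h.bind (n' := 0) fun S' _ hT' => .done (hT.trans (avail_subset hT'))

theorem Computes.mono_cost {S T : Set (Ω → F)} {c c' : ℝ} (h : Computes S c T) (hc : c ≤ c') :
    Computes S c' T :=
  h.mono Set.subset_union_left hc Set.subset_union_left

theorem Computes.mono_source {S S' T : Set (Ω → F)} {c : ℝ} (h : Computes S c T)
    (hS : S ⊆ S') : Computes S' c T :=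
  h.mono (hS.trans Set.subset_union_left) le_rfl Set.subset_union_left

theorem Computes.mono_target {S T T' : Set (Ω → F)} {c : ℝ} (h : Computes S c T)
    (hT : T' ⊆ avail T) : Computes S c T' :=
  h.mono Set.subset_union_left le_rfl hT

/-- Sequential composition: the second computation may use everything known to the first and
everything that the first has computed. -/
theorem Computes.bind {S T U : Set (Ω → F)} {c c' : ℝ} (h : Computes S c T)
    (hU : ∀ S', S ⊆ S' → T ⊆ avail S' → Computes S' c' U) : Computes S (c + c') U := by
  obtain ⟨n, hn, h⟩ := h
  obtain ⟨n', hn', h'⟩ := hU (S ∪ T) Set.subset_union_left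
    (Set.subset_union_right.trans Set.subset_union_left)
  refine ⟨n + n', by push_cast; linarith, h.bind fun S' hS hT => h'.mono_source ?_⟩
  exact Set.union_subset (hS.trans Set.subset_union_left) hT

theorem Computes.union {S T U : Set (Ω → F)} {c c' : ℝ} (h : Computes S c T)
    (hU : Computes S c' U) : Computes S (c + c') (T ∪ U) :=
  h.bind fun S' hS hT => (hU.mono_source hS).bind (c' := 0) (fun S'' hS'' hU'' =>
    .of_subset le_rfl (Set.union_subset (hT.trans (avail_mono hS'')) hU'')) |>.mono_cost (by simp)

theorem Computes.biUnion {κ : Type*} {S : Set (Ω → F)} {c : ℝ} (s : Finset κ)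
    {T : κ → Set (Ω → F)} (h : ∀ i ∈ s, Computes S c (T i)) :
    Computes S (s.card * c) (⋃ i ∈ s, T i) := by
  classical
  induction s using Finset.induction_on with
  | empty => simpa using Computes.of_subset le_rfl (Set.empty_subset _)
  | insert a s ha ih =>
    rw [Finset.set_biUnion_insert, Finset.card_insert_of_notMem ha]
    refine ((h a (Finset.mem_insert_self _ _)).union
      (ih fun i hi => h i (Finset.mem_insert_of_mem hi))).mono_cost (le_of_eq ?_)
    push_cast; ring

/-- The same computation carried out for every index below `n`. -/
theorem Computes.forall_lt {S : Set (Ω → F)} {c : ℝ} {n : ℕ} {T : ℕ → Set (Ω → F)}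
    (h : ∀ i < n, Computes S c (T i)) :
    Computes S (n * c) {f | ∃ i < n, f ∈ T i} := by
  have := Computes.biUnion (Finset.range n) fun i hi => h i (Finset.mem_range.1 hi)
  rw [Finset.card_range] at this
  refine this.mono_target ?_
  rintro f ⟨i, hi, hf⟩
  exact mem_avail_of_mem (Set.mem_biUnion (Finset.mem_coe.2 (Finset.mem_range.2 hi)) hf)

theorem computes_op {S : Set (Ω → F)} (op : Op) {a b f : Ω → F} (ha : a ∈ avail S)
    (hb : b ∈ avail S) (hf : ∀ ξ, op.apply (a ξ) (b ξ) = some (f ξ)) : Computes S 1 {f} :=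
  ⟨1, by simp, .step op ha hb hf
    (.done (Set.singleton_subset_iff.2 (mem_avail_of_mem (Set.mem_insert _ _))))⟩

theorem computes_add {S : Set (Ω → F)} {a b : Ω → F} (ha : a ∈ avail S) (hb : b ∈ avail S) :
    Computes S 1 {a + b} :=
  computes_op .add ha hb fun _ => rfl

theorem computes_sub {S : Set (Ω → F)} {a b : Ω → F} (ha : a ∈ avail S) (hb : b ∈ avail S) :
    Computes S 1 {a - b} :=
  computes_op .sub ha hb fun _ => rfl

theorem Steps.of_run [Nonempty Ω] {u : ι → Ω → F} {m' : Ω → List F} {T : Set (Ω → F)}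
    (hT : ∀ f ∈ T, ∃ p : Operand F ι, ∀ ξ, p.val (fun i => u i ξ) (m' ξ) = some (f ξ))
    (Is : List (Instr F ι)) {m : List (Ω → F)} {S : Set (Ω → F)}
    (hu : ∀ i, u i ∈ avail S) (hm : ∀ f ∈ m, f ∈ avail S)
    (hrun : ∀ ξ, run (fun i => u i ξ) Is (m.map fun g => g ξ) = some (m' ξ)) :
    Steps S Is.length T := by
  induction Is generalizing m S with
  | nil =>
    simp only [run, Option.some.injEq] at hrun
    refine .done fun f hf => ?_
    obtain ⟨p, hp⟩ := hT f hf
    exact p.mem_avail hu hm (by simpa only [hrun] using hp)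
  | cons I Is ih =>
    simp only [run, Instr.exec, Option.bind_eq_some_iff] at hrun
    choose v hv hrun using hrun
    choose a ha hv using hv
    choose b hb hv using hv
    refine .step I.op (I.fst.mem_avail hu hm ha) (I.snd.mem_avail hu hm hb) hv
      (ih (m := m ++ [v]) (fun i => avail_mono (Set.subset_insert _ _) (hu i)) ?_ ?_)
    · intro f hf
      rcases List.mem_append.1 hf with hf | hf
      · exact avail_mono (Set.subset_insert _ _) (hm f hf)
      · rw [List.mem_singleton.1 hf]
        exact mem_avail_of_mem (Set.mem_insert _ _)
    · simpa using hrun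

/-- A program may be run on any available functions. -/
theorem Program.computes [Nonempty Ω] (P : Program F ι o) {S : Set (Ω → F)} {u : ι → Ω → F}
    (hu : ∀ i, u i ∈ avail S) {y : o → Ω → F}
    (hP : ∀ ξ, P.Returns (fun i => u i ξ) (fun j => y j ξ)) :
    Computes S P.cost (Set.range y) := by
  choose m hm hy using hP
  refine (Steps.of_run (u := u) (m' := m) ?_ P.instrs (m := []) hu (by simp)
    (by simpa using hm)).computes
  rintro _ ⟨j, rfl⟩
  exact ⟨P.out j, fun ξ => hy ξ j⟩

theorem Steps.exists_run {S T : Set ((ι → F) → F)} {n : ℕ} (h : Steps S n T)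
    {m : List ((ι → F) → F)}
    (hS : ∀ f ∈ S, ∃ p : Operand F ι, ∀ x, p.val x (m.map fun g => g x) = some (f x)) :
    ∃ (Is : List (Instr F ι)) (m' : List ((ι → F) → F)), Is.length ≤ n ∧
      (∀ x, run x Is (m.map fun g => g x) = some (m'.map fun g => g x)) ∧
      ∀ f ∈ T, ∃ p : Operand F ι, ∀ x, p.val x (m'.map fun g => g x) = some (f x) := by
  have key : ∀ {S : Set ((ι → F) → F)} {m : List ((ι → F) → F)},
      (∀ f ∈ S, ∃ p : Operand F ι, ∀ x, p.val x (m.map fun g => g x) = some (f x)) →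
      ∀ f ∈ avail S, ∃ p : Operand F ι, ∀ x, p.val x (m.map fun g => g x) = some (f x) := by
    rintro S m hS f (hf | ⟨c, rfl⟩)
    · exact hS f hf
    · exact ⟨.const c, fun x => rfl⟩
  induction h generalizing m with
  | done h => exact ⟨[], m, Nat.zero_le _, fun x => rfl, fun f hf => key hS f (h hf)⟩
  | @step S T n op a b f ha hb hf h ih =>
    obtain ⟨pa, hpa⟩ := key hS a ha
    obtain ⟨pb, hpb⟩ := key hS b hb
    obtain ⟨Is, m', hlen, hrun, hT⟩ := ih (m := m ++ [f]) (by
      rintro g (rfl | hg)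
      · exact ⟨.reg m.length, fun x => by simp [Operand.val]⟩
      · obtain ⟨p, hp⟩ := hS g hg
        refine ⟨p, fun x => ?_⟩
        rw [List.map_append]
        exact Operand.val_append (hp x) _)
    refine ⟨⟨op, pa, pb⟩ :: Is, m', by simpa using hlen, fun x => ?_, hT⟩
    have := hrun x
    simp only [List.map_append, List.map_cons, List.map_nil] at this
    simp [run, Instr.exec, hpa, hpb, hf, this]

/-- What can be computed from the coordinate functions is computed by a program. -/
theorem Computes.exists_program {y : o → (ι → F) → F} {c : ℝ}
    (h : Computes (Set.range fun (i : ι) (x : ι → F) => x i) c (Set.range y)) :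
    ∃ P : Program F ι o, (P.cost : ℝ) ≤ c ∧ ∀ x, P.Returns x (fun j => y j x) := by
  obtain ⟨n, hn, h⟩ := h
  obtain ⟨Is, m, hlen, hrun, hT⟩ := h.exists_run (m := []) (by
    rintro _ ⟨i, rfl⟩
    exact ⟨.input i, fun x => rfl⟩)
  choose p hp using fun j => hT (y j) ⟨j, rfl⟩
  refine ⟨⟨Is, p⟩, le_trans (Nat.cast_le.2 hlen) hn, fun x =>
    ⟨m.map fun g => g x, ?_, fun j => hp j x⟩⟩
  simpa using hrun x

end SLP

/-! ### Polynomials and matrices of computed functions -/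

namespace SLP

open Polynomial

variable {F Ω : Type*} [Field F]

theorem Computes.forall_lt_coeff {S : Set (Ω → F)} {c : ℝ} {n : ℕ} {p : ℕ → (Ω → F)[X]}
    (h : ∀ i < n, Computes S c (Set.range (p i).coeff)) :
    Computes S (n * c) {f | ∃ i < n, ∃ j, (p i).coeff j = f} :=
  Computes.forall_lt h

theorem computes_coeff_of_lt {S : Set (Ω → F)} {m : ℕ} {p : (Ω → F)[X]} {c : ℝ}
    (h : ∀ i < m, Computes S c {p.coeff i}) (hp : p ∈ degreeLT (Ω → F) m) :
    Computes S (m * c) (Set.range p.coeff) := by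
  refine (Computes.forall_lt h).mono_target ?_
  rintro _ ⟨i, rfl⟩
  rcases lt_or_ge i m with hi | hi
  · exact mem_avail_of_mem ⟨i, hi, rfl⟩
  · rw [coeff_eq_zero_of_degree_lt ((mem_degreeLT.1 hp).trans_le (by exact_mod_cast hi))]
    exact zero_mem_avail _

theorem computes_poly_add {S : Set (Ω → F)} {m : ℕ} {p q : (Ω → F)[X]}
    (hp : p ∈ degreeLT (Ω → F) m) (hq : q ∈ degreeLT (Ω → F) m)
    (hpS : ∀ i, p.coeff i ∈ avail S) (hqS : ∀ i, q.coeff i ∈ avail S) :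
    Computes S m (Set.range (p + q).coeff) := by
  refine (computes_coeff_of_lt (fun i _ => ?_) (add_mem hp hq)).mono_cost (mul_one _).le
  rw [coeff_add]
  exact computes_add (hpS i) (hqS i)

theorem computes_poly_sub {S : Set (Ω → F)} {m : ℕ} {p q : (Ω → F)[X]}
    (hp : p ∈ degreeLT (Ω → F) m) (hq : q ∈ degreeLT (Ω → F) m)
    (hpS : ∀ i, p.coeff i ∈ avail S) (hqS : ∀ i, q.coeff i ∈ avail S) :
    Computes S m (Set.range (p - q).coeff) := by
  refine (computes_coeff_of_lt (fun i _ => ?_) (sub_mem hp hq)).mono_cost (mul_one _).le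
  rw [coeff_sub]
  exact computes_sub (hpS i) (hqS i)

theorem mul_mem_degreeLT_of_succ {R : Type*} [CommRing R] {p q : R[X]} {m n : ℕ}
    (hp : p ∈ degreeLT R m) (hq : q ∈ degreeLT R (n + 1)) : p * q ∈ degreeLT R (m + n) := by
  rw [mem_degreeLT] at *
  refine (degree_lt_iff_coeff_zero _ _).2 fun k hk => ?_
  rw [coeff_mul]
  refine Finset.sum_eq_zero fun x hx => ?_
  have := Finset.HasAntidiagonal.mem_antidiagonal.1 hx
  rcases le_or_gt m x.1 with h | h
  · rw [(degree_lt_iff_coeff_zero _ _).1 hp _ h, zero_mul]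
  · rw [(degree_lt_iff_coeff_zero _ _).1 hq _ (by omega), mul_zero]

theorem mul_mem_degreeLT {R : Type*} [CommRing R] {p q : R[X]} {m n : ℕ}
    (hp : p ∈ degreeLT R m) (hq : q ∈ degreeLT R n) : p * q ∈ degreeLT R (m + n) :=
  mul_mem_degreeLT_of_succ hp (degreeLT_mono n.le_succ hq)

theorem X_pow_mul_mem_degreeLT {R : Type*} [CommRing R] {p : R[X]} {m : ℕ} (n : ℕ)
    (hp : p ∈ degreeLT R m) : X ^ n * p ∈ degreeLT R (n + m) := by
  rw [mem_degreeLT] at *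
  refine (degree_lt_iff_coeff_zero _ _).2 fun k hk => ?_
  rw [coeff_X_pow_mul', if_pos (by omega)]
  exact (degree_lt_iff_coeff_zero _ _).1 hp _ (by omega)

theorem coeff_X_pow_mul_mem_avail {S : Set (Ω → F)} {p : (Ω → F)[X]} (n : ℕ)
    (hp : ∀ i, p.coeff i ∈ avail S) (i : ℕ) : (X ^ n * p).coeff i ∈ avail S := by
  rw [coeff_X_pow_mul']
  split_ifs
  · exact hp _
  · exact zero_mem_avail _

theorem coeff_map_mem_avail (S : Set (Ω → F)) (p : F[X]) (i : ℕ) :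
    (p.map (algebraMap F (Ω → F))).coeff i ∈ avail S := by
  rw [coeff_map]
  exact const_mem_avail _ _

theorem coeff_modByMonic_X_pow {R : Type*} [CommRing R] (p : R[X]) (m i : ℕ) :
    (p %ₘ X ^ m).coeff i = if i < m then p.coeff i else 0 := by
  nontriviality R
  split_ifs with h
  · conv_rhs => rw [← modByMonic_add_div p (X ^ m)]
    rw [coeff_add, coeff_X_pow_mul', if_neg (by omega), add_zero]
  · refine coeff_eq_zero_of_degree_lt ((degree_modByMonic_lt _ (monic_X_pow m)).trans_le ?_)
    rw [degree_X_pow]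
    exact_mod_cast not_lt.1 h

theorem coeff_divByMonic_X_pow {R : Type*} [CommRing R] (p : R[X]) (m i : ℕ) :
    (p /ₘ X ^ m).coeff i = p.coeff (i + m) := by
  conv_rhs => rw [← modByMonic_add_div p (X ^ m)]
  rw [coeff_add, coeff_modByMonic_X_pow, if_neg (by omega), zero_add, coeff_X_pow_mul]

theorem coeff_modByMonic_X_pow_mem_avail {S : Set (Ω → F)} {p : (Ω → F)[X]} (m : ℕ)
    (hp : ∀ i, p.coeff i ∈ avail S) (i : ℕ) : (p %ₘ X ^ m).coeff i ∈ avail S := by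
  rw [coeff_modByMonic_X_pow]
  split_ifs
  · exact hp _
  · exact zero_mem_avail _

theorem coeff_divByMonic_X_pow_mem_avail {S : Set (Ω → F)} {p : (Ω → F)[X]} (m : ℕ)
    (hp : ∀ i, p.coeff i ∈ avail S) (i : ℕ) : (p /ₘ X ^ m).coeff i ∈ avail S := by
  rw [coeff_divByMonic_X_pow]
  exact hp _

theorem modByMonic_X_pow_mem_degreeLT {R : Type*} [CommRing R] (p : R[X]) (m : ℕ) :
    p %ₘ X ^ m ∈ degreeLT R m := by
  refine mem_degreeLT.2 ((degree_lt_iff_coeff_zero _ _).2 fun k hk => ?_)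
  rw [coeff_modByMonic_X_pow, if_neg (by omega)]

theorem divByMonic_X_pow_mem_degreeLT {R : Type*} [CommRing R] {p : R[X]} {m n : ℕ}
    (hp : p ∈ degreeLT R (n + m)) : p /ₘ X ^ m ∈ degreeLT R n := by
  refine mem_degreeLT.2 ((degree_lt_iff_coeff_zero _ _).2 fun k hk => ?_)
  rw [coeff_divByMonic_X_pow]
  exact (degree_lt_iff_coeff_zero _ _).1 (mem_degreeLT.1 hp) _ (by omega)

variable (F Ω) in
/-- Polynomials of degree less than `m`, whose coefficients are functions on `Ω`, can be multiplied
within `c` operations. -/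
def PolyMulCost (m : ℕ) (c : ℝ) : Prop :=
  ∀ (S : Set (Ω → F)) (p q : (Ω → F)[X]), p ∈ degreeLT (Ω → F) m → q ∈ degreeLT (Ω → F) m →
    (∀ i, p.coeff i ∈ avail S) → (∀ i, q.coeff i ∈ avail S) →
    Computes S c (Set.range (p * q).coeff)

theorem PolyMulCost.mono {m m' : ℕ} {c c' : ℝ} (h : PolyMulCost F Ω m c) (hm : m' ≤ m)
    (hc : c ≤ c') : PolyMulCost F Ω m' c' := fun S p q hp hq hpS hqS =>
  (h S p q (degreeLT_mono hm hp) (degreeLT_mono hm hq) hpS hqS).mono_cost hc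

/-- Multiplication by blocks. -/
theorem PolyMulCost.double {m : ℕ} {c : ℝ} (h : PolyMulCost F Ω m c) :
    PolyMulCost F Ω (2 * m) (4 * c + 12 * m) := by
  intro S p q hp hq hpS hqS
  set p₀ := p %ₘ X ^ m
  set p₁ := p /ₘ X ^ m
  set q₀ := q %ₘ X ^ m
  set q₁ := q /ₘ X ^ m
  have hp₀ : p₀ ∈ degreeLT (Ω → F) m := modByMonic_X_pow_mem_degreeLT _ _
  have hq₀ : q₀ ∈ degreeLT (Ω → F) m := modByMonic_X_pow_mem_degreeLT _ _
  have hp₁ : p₁ ∈ degreeLT (Ω → F) m := divByMonic_X_pow_mem_degreeLT (by rwa [← two_mul])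
  have hq₁ : q₁ ∈ degreeLT (Ω → F) m := divByMonic_X_pow_mem_degreeLT (by rwa [← two_mul])
  have e : p * q = (p₀ * q₀ + X ^ m * (p₀ * q₁ + p₁ * q₀)) + X ^ (2 * m) * (p₁ * q₁) := by
    conv_lhs => rw [← modByMonic_add_div p (X ^ m), ← modByMonic_add_div q (X ^ m)]
    ring
  have a₀ := coeff_modByMonic_X_pow_mem_avail m hpS
  have a₁ := coeff_divByMonic_X_pow_mem_avail m hpS
  have b₀ := coeff_modByMonic_X_pow_mem_avail m hqS
  have b₁ := coeff_divByMonic_X_pow_mem_avail m hqS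
  have H := (((h S p₀ q₀ hp₀ hq₀ a₀ b₀).union (h S p₀ q₁ hp₀ hq₁ a₀ b₁)).union
    (h S p₁ q₀ hp₁ hq₀ a₁ b₀)).union (h S p₁ q₁ hp₁ hq₁ a₁ b₁)
  refine (H.bind (c' := 2 * m + (4 * m + 4 * m) + (2 * m : ℕ)) fun S₁ _ hS₁ => ?_).mono_cost ?_
  swap
  · push_cast; linarith
  have g : ∀ {r : (Ω → F)[X]}, Set.range r.coeff ⊆ avail S₁ → ∀ i, r.coeff i ∈ avail S₁ :=
    fun h i => h ⟨i, rfl⟩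
  simp only [Set.union_subset_iff] at hS₁
  obtain ⟨⟨⟨s₀₀, s₀₁⟩, s₁₀⟩, s₁₁⟩ := hS₁
  have e2 : m + m = 2 * m := (two_mul m).symm
  have d₀₀ := e2 ▸ mul_mem_degreeLT hp₀ hq₀
  have d₀₁ := e2 ▸ mul_mem_degreeLT hp₀ hq₁
  have d₁₀ := e2 ▸ mul_mem_degreeLT hp₁ hq₀
  have d₁₁ := e2 ▸ mul_mem_degreeLT hp₁ hq₁
  have dm := degreeLT_mono (R := Ω → F) (show m + 2 * m ≤ 4 * m by omega)
  refine ((computes_poly_add d₀₁ d₁₀ (g s₀₁) (g s₁₀)).bind (c' := (4 * m : ℕ) + (4 * m : ℕ))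
    fun S₂ h₂ hS₂ => ?_).mono_cost (by push_cast; linarith [m.cast_nonneg (α := ℝ)])
  have hmid := dm (X_pow_mul_mem_degreeLT m (add_mem d₀₁ d₁₀))
  have hlow := degreeLT_mono (R := Ω → F) (show 2 * m ≤ 4 * m by omega) d₀₀
  refine (computes_poly_add hlow hmid (fun i => avail_mono h₂ (g s₀₀ i))
    (coeff_X_pow_mul_mem_avail m fun i => hS₂ ⟨i, rfl⟩)).bind fun S₃ h₃ hS₃ => ?_
  rw [e]
  refine computes_poly_add (add_mem hlow hmid)
    (degreeLT_mono (show 2 * m + 2 * m ≤ 4 * m by omega) (X_pow_mul_mem_degreeLT (2 * m) d₁₁))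
    (fun i => hS₃ ⟨i, rfl⟩)
    (coeff_X_pow_mul_mem_avail _ fun i => avail_mono (h₂.trans h₃) (g s₁₁ i))

theorem coeff_polyOfCoeffs {d : ℕ} (a : Fin d → F) (i : ℕ) :
    (polyOfCoeffs a).coeff i = if h : i < d then a ⟨i, h⟩ else 0 := by
  simp only [polyOfCoeffs, finsetSum_coeff, coeff_C_mul, coeff_X_pow, mul_ite, mul_one, mul_zero]
  split_ifs with h
  · rw [Finset.sum_eq_single ⟨i, h⟩] <;> simp +contextual [Fin.ext_iff, eq_comm]
  · exact Finset.sum_eq_zero fun j _ => if_neg (by omega)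

theorem polyOfCoeffs_eval {d : ℕ} {p : (Ω → F)[X]} (hp : p ∈ degreeLT (Ω → F) d) (ξ : Ω) :
    polyOfCoeffs (fun i : Fin d => p.coeff i ξ) = p.map (Pi.evalRingHom (fun _ => F) ξ) := by
  ext i
  rw [coeff_polyOfCoeffs, coeff_map]
  split_ifs with h
  · rfl
  · rw [(degree_lt_iff_coeff_zero _ _).1 (mem_degreeLT.1 hp) _ (not_lt.1 h), map_zero]

theorem polyMulCost_of_program [Nonempty Ω] {d : ℕ}
    {P : Program F (Fin d ⊕ Fin d) (Fin (2 * d))} (hP : MultipliesPolys d P) :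
    PolyMulCost F Ω d P.cost := by
  intro S p q hp hq hpS hqS
  have H := P.computes (S := S)
    (u := Sum.elim (fun i : Fin d => p.coeff i) (fun i : Fin d => q.coeff i))
    (y := fun j : Fin (2 * d) => (p * q).coeff j)
    (by rintro (i | i); exacts [hpS i, hqS i]) (by
      intro ξ
      obtain ⟨c, hc, hmul⟩ := hP (fun i => p.coeff i ξ) (fun i => q.coeff i ξ)
      rw [polyOfCoeffs_eval hp, polyOfCoeffs_eval hq, ← Polynomial.map_mul] at hmul
      convert hc using 1
      · ext (i | i) <;> rfl
      · funext j
        have := congrArg (fun r => r.coeff (j : ℕ)) hmul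
        simp only [coeff_polyOfCoeffs, coeff_map, j.2, dif_pos] at this
        exact this.symm)
  refine H.mono_target ?_
  rintro _ ⟨i, rfl⟩
  rcases lt_or_ge i (2 * d) with hi | hi
  · exact mem_avail_of_mem ⟨⟨i, hi⟩, rfl⟩
  · rw [(degree_lt_iff_coeff_zero _ _).1 (mem_degreeLT.1 (mul_mem_degreeLT hp hq)) i (by omega)]
    exact zero_mem_avail _

/-- Two field elements cannot be multiplied without any operation. -/
theorem one_le_cost_of_multipliesPolys {P : Program F (Fin 1 ⊕ Fin 1) (Fin (2 * 1))}
    (hP : MultipliesPolys 1 P) : 1 ≤ P.cost := by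
  by_contra! h
  have h0 : P.instrs = [] := List.length_eq_zero_iff.1 (Nat.lt_one_iff.1 h)
  have key : ∀ a b : F,
      (P.out 0).val (Sum.elim (fun _ => a) (fun _ => b)) [] = some (a * b) := by
    intro a b
    obtain ⟨c, ⟨m, hm, hout⟩, hc⟩ := hP (fun _ => a) (fun _ => b)
    simp only [h0, run, Option.some.injEq] at hm
    have := congrArg (fun r => r.coeff 0) hc
    simp only [mul_coeff_zero, coeff_polyOfCoeffs] at this
    rw [hm, hout 0]
    simpa using this
  cases ho : P.out 0 with
  | input i =>
    rw [ho] at key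
    cases i with
    | inl i => simpa [Operand.val] using key 1 0
    | inr i => simpa [Operand.val] using key 0 1
  | const c =>
    rw [ho] at key
    have h1 : c = 1 * 1 := by simpa [Operand.val] using key 1 1
    have h2 : c = 0 * 0 := by simpa [Operand.val] using key 0 0
    rw [h1] at h2
    simp at h2
  | reg n =>
    rw [ho] at key
    simpa [Operand.val] using key 1 1

variable (F Ω) in
/-- Matrices of size `n × n`, whose entries are functions on `Ω`, can be multiplied within `c`
operations. Matrices are indexed by all natural numbers, of which those below `n` matter, so that
blocks can be cut out without casts between index types. -/
def MatMulCost (n : ℕ) (c : ℝ) : Prop :=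
  ∀ (S : Set (Ω → F)) (A B : ℕ → ℕ → Ω → F),
    (∀ i < n, ∀ j < n, A i j ∈ avail S) → (∀ i < n, ∀ j < n, B i j ∈ avail S) →
    Computes S c {f | ∃ i < n, ∃ j < n, ∑ k ∈ Finset.range n, A i k * B k j = f}

theorem matMulCost_of_program [Nonempty Ω] {n : ℕ}
    {P : Program F ((Fin n × Fin n) ⊕ (Fin n × Fin n)) (Fin n × Fin n)}
    (hP : MultipliesMatrices n P) : MatMulCost F Ω n P.cost := by
  intro S A B hA hB
  have H := P.computes (S := S)
    (u := Sum.elim (fun p : Fin n × Fin n => A p.1 p.2) (fun p : Fin n × Fin n => B p.1 p.2))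
    (y := fun p : Fin n × Fin n => ∑ k ∈ Finset.range n, A p.1 k * B k p.2)
    (by rintro (i | i); exacts [hA _ i.1.2 _ i.2.2, hB _ i.1.2 _ i.2.2]) (by
      intro ξ
      convert hP (Matrix.of fun i j => A i j ξ) (Matrix.of fun i j => B i j ξ) using 1
      · ext (i | i) <;> rfl
      · funext p
        simp [Matrix.mul_apply, Finset.sum_range])
  refine H.mono_target ?_
  rintro _ ⟨i, hi, j, hj, rfl⟩
  exact mem_avail_of_mem ⟨(⟨i, hi⟩, ⟨j, hj⟩), rfl⟩

end SLP

/-! ### Fast Chinese remaindering with fixed moduli -/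

namespace SLP

open Polynomial

variable {F Ω : Type*} [Field F]

theorem map_mem_degreeLT {R R' : Type*} [CommRing R] [CommRing R'] (φ : R →+* R') {p : R[X]} {m : ℕ}
    (hp : p ∈ degreeLT R m) : p.map φ ∈ degreeLT R' m :=
  mem_degreeLT.2 (degree_map_le.trans_lt (mem_degreeLT.1 hp))

theorem modByMonic_mem_degreeLT {R : Type*} [CommRing R] [Nontrivial R] (p : R[X]) {q : R[X]}
    (hq : q.Monic) : p %ₘ q ∈ degreeLT R q.natDegree := by
  rw [mem_degreeLT, ← degree_eq_natDegree hq.ne_zero]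
  exact degree_modByMonic_lt _ hq

theorem mem_degreeLT_natDegree_succ {R : Type*} [CommRing R] (p : R[X]) :
    p ∈ degreeLT R (p.natDegree + 1) := by
  rw [mem_degreeLT]
  exact degree_le_natDegree.trans_lt (by exact_mod_cast p.natDegree.lt_succ_self)

/-- Division with the precomputed quotient `T` of `X ^ (2 * m)` by `B`: if `f` has degree less than
`2 * m`, the quotient of `f` by `B` is the upper part of the product of `T` with the upper part of
`f`. -/
theorem modByMonic_eq_sub_mul {R : Type*} [CommRing R] [Nontrivial R] {B f : R[X]} (hB : B.Monic)
    (hf : f ∈ degreeLT R (2 * B.natDegree)) :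
    f %ₘ B = f -
      (((f /ₘ X ^ B.natDegree) * (X ^ (2 * B.natDegree) /ₘ B)) /ₘ X ^ B.natDegree) * B := by
  set m := B.natDegree with hm
  set T := X ^ (2 * m) /ₘ B
  set R' := X ^ (2 * m) %ₘ B
  set hi := f /ₘ X ^ m
  set lo := f %ₘ X ^ m
  set Q := (hi * T) /ₘ X ^ m
  set P := (hi * T) %ₘ X ^ m
  have e₁ : R' + B * T = X ^ (2 * m) := modByMonic_add_div _ _
  have e₂ : lo + X ^ m * hi = f := modByMonic_add_div _ _
  have e₃ : P + X ^ m * Q = hi * T := modByMonic_add_div _ _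
  have key : X ^ m * (f - Q * B) = X ^ m * lo + hi * R' + P * B := by
    have h2 : (X : R[X]) ^ (2 * m) = X ^ m * X ^ m := by ring
    linear_combination (-X ^ m) * e₂ - hi * e₁ - B * e₃ + hi * h2
  have hhi : hi ∈ degreeLT R m := divByMonic_X_pow_mem_degreeLT (by rwa [← two_mul])
  have hmem : X ^ m * (f - Q * B) ∈ degreeLT R (m + m) := by
    rw [key]
    exact add_mem (add_mem (X_pow_mul_mem_degreeLT m (modByMonic_X_pow_mem_degreeLT _ _))
      (mul_mem_degreeLT hhi (modByMonic_mem_degreeLT _ hB)))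
      (mul_mem_degreeLT_of_succ (modByMonic_X_pow_mem_degreeLT _ _) (mem_degreeLT_natDegree_succ B))
  have hdeg : (f - Q * B).degree < (m : WithBot ℕ) := by
    refine (degree_lt_iff_coeff_zero _ _).2 fun k hk => ?_
    have := (degree_lt_iff_coeff_zero _ _).1 (mem_degreeLT.1 hmem) (k + m) (by omega)
    rwa [coeff_X_pow_mul] at this
  refine (div_modByMonic_unique Q _ hB ⟨by ring, ?_⟩).2
  rwa [degree_eq_natDegree hB.ne_zero]

variable (F) in
/-- The product of the `(X - s) ^ n` for the `2 ^ k` points `s = t, t + 1, …`: the modulus at a node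
of height `k` of the remainder tree. -/
noncomputable def treeModulus (n k t : ℕ) : F[X] :=
  ∏ s ∈ Finset.range (2 ^ k), (X - C ((t + s : ℕ) : F)) ^ n

theorem treeModulus_monic (n k t : ℕ) : (treeModulus F n k t).Monic :=
  monic_prod_of_monic _ _ fun _ _ => (monic_X_sub_C _).pow _

theorem natDegree_treeModulus (n k t : ℕ) : (treeModulus F n k t).natDegree = n * 2 ^ k := by
  rw [treeModulus, natDegree_prod_of_monic _ _ fun _ _ => (monic_X_sub_C _).pow _]
  rw [Finset.sum_congr rfl fun s _ => show ((X - C ((t + s : ℕ) : F)) ^ n).natDegree = n by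
    rw [natDegree_pow, natDegree_X_sub_C, mul_one]]
  simp [mul_comm]

theorem treeModulus_succ (n k t : ℕ) :
    treeModulus F n (k + 1) t = treeModulus F n k t * treeModulus F n k (t + 2 ^ k) := by
  rw [treeModulus, pow_succ, mul_two, Finset.prod_range_add]
  simp only [treeModulus, add_assoc]

theorem isCoprime_treeModulus [CharZero F] (n k t : ℕ) :
    IsCoprime (treeModulus F n k t) (treeModulus F n k (t + 2 ^ k)) := by
  refine IsCoprime.prod_left fun i hi => IsCoprime.prod_right fun j _ => IsCoprime.pow ?_
  refine isCoprime_X_sub_C_of_isUnit_sub (sub_ne_zero_of_ne fun h => ?_).isUnit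
  have := Finset.mem_range.1 hi
  have := Nat.cast_injective h
  omega

theorem pow_dvd_treeModulus {n k t s : ℕ} (hs : s < 2 ^ k) :
    (X - C ((t + s : ℕ) : F)) ^ n ∣ treeModulus F n k t :=
  Finset.dvd_prod_of_mem (fun s => (X - C ((t + s : ℕ) : F)) ^ n) (Finset.mem_range.2 hs)

theorem pow_dvd_map_treeModulus {n k t s : ℕ} (hs : s < 2 ^ k) :
    (X - C ((t + s : ℕ) : Ω → F)) ^ n ∣ (treeModulus F n k t).map (algebraMap F (Ω → F)) := by
  simpa using map_dvd (mapRingHom (algebraMap F (Ω → F)))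
    (pow_dvd_treeModulus (F := F) (n := n) (t := t) hs)

theorem modByMonic_modByMonic_of_dvd {R : Type*} [CommRing R] {p q : R[X]} (f : R[X]) (hp : p.Monic)
    (h : p ∣ q) : (f %ₘ q) %ₘ p = f %ₘ p := by
  refine modByMonic_eq_of_dvd_sub hp (h.trans ?_)
  exact ⟨-(f /ₘ q), by linear_combination modByMonic_add_div f q⟩

theorem modByMonic_treeModulus_modByMonic (n k t : ℕ) (f : (Ω → F)[X]) {s : ℕ} (hs : s < 2 ^ k) :
    (f %ₘ (treeModulus F n k t).map (algebraMap F (Ω → F))) %ₘ (X - C ((t + s : ℕ) : Ω → F)) ^ n =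
      f %ₘ (X - C ((t + s : ℕ) : Ω → F)) ^ n :=
  modByMonic_modByMonic_of_dvd f ((monic_X_sub_C _).pow _) (pow_dvd_map_treeModulus hs)

variable [Nonempty Ω]

/-- Reduction modulo a fixed monic polynomial costs two multiplications, because quotients of powers
of `X` by it are constants of the program. -/
theorem computes_modByMonic {m : ℕ} {c : ℝ} (hM : PolyMulCost F Ω (2 * m) c) (hm : 1 ≤ m) {B : F[X]}
    (hB : B.Monic) (hBm : B.natDegree = m) {S : Set (Ω → F)} {f : (Ω → F)[X]}
    (hf : f ∈ degreeLT (Ω → F) (2 * m)) (hfS : ∀ i, f.coeff i ∈ avail S) :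
    Computes S (2 * c + m) (Set.range (f %ₘ B.map (algebraMap F (Ω → F))).coeff) := by
  subst hBm
  set B' := B.map (algebraMap F (Ω → F)) with hB'
  have hmon : B'.Monic := hB.map _
  have hnd : B'.natDegree = B.natDegree := hB.natDegree_map _
  set m := B.natDegree
  have e := modByMonic_eq_sub_mul hmon (hnd.symm ▸ hf)
  rw [hnd] at e
  have hT : X ^ (2 * m) /ₘ B' = (X ^ (2 * m) /ₘ B).map (algebraMap F (Ω → F)) := by
    rw [map_divByMonic _ hB, Polynomial.map_pow, map_X]
  have hTmem : X ^ (2 * m) /ₘ B' ∈ degreeLT (Ω → F) (m + 1) := by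
    rw [hT]
    refine map_mem_degreeLT _ ?_
    have := mem_degreeLT_natDegree_succ (X ^ (2 * m) /ₘ B)
    rwa [natDegree_divByMonic _ hB, natDegree_X_pow, show 2 * m - m = m by omega] at this
  have hhi : f /ₘ X ^ m ∈ degreeLT (Ω → F) m := divByMonic_X_pow_mem_degreeLT (by rwa [← two_mul])
  set T := X ^ (2 * m) /ₘ B'
  have hQ : ((f /ₘ X ^ m) * T) /ₘ X ^ m ∈ degreeLT (Ω → F) (2 * m) :=
    divByMonic_X_pow_mem_degreeLT
      (degreeLT_mono (by omega) (mul_mem_degreeLT_of_succ hhi hTmem))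
  have hB'mem : B' ∈ degreeLT (Ω → F) (2 * m) :=
    degreeLT_mono (by omega) (hnd ▸ mem_degreeLT_natDegree_succ B')
  refine ((hM S _ T (degreeLT_mono (by omega) hhi) (degreeLT_mono (by omega) hTmem)
    (coeff_divByMonic_X_pow_mem_avail m hfS)
    (hT ▸ coeff_map_mem_avail S _)).bind (c' := c + m) fun S₁ h₁ hS₁ => ?_).mono_cost (by linarith)
  refine (hM S₁ _ B' hQ hB'mem (coeff_divByMonic_X_pow_mem_avail m fun i => hS₁ ⟨i, rfl⟩)
    (coeff_map_mem_avail S₁ B)).bind fun S₂ h₂ hS₂ => ?_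
  refine (computes_coeff_of_lt (m := m) (c := 1) (fun i _ => ?_) ?_).mono_cost (mul_one _).le
  · rw [e, coeff_sub]
    exact computes_sub (avail_mono (h₁.trans h₂) (hfS i)) (hS₂ ⟨i, rfl⟩)
  · have := modByMonic_mem_degreeLT f hmon
    rwa [hnd] at this

/-- Chinese remaindering: `W` inverts `A` modulo `B`. -/
theorem eq_add_mul_modByMonic {R : Type*} [CommRing R] [Nontrivial R] {A B W f : R[X]}
    (hA : A.Monic) (hB : B.Monic) (hf : f ∈ degreeLT R (B.natDegree + A.natDegree))
    (hW : B ∣ W * A - 1) :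
    f = f %ₘ A + A * (((f %ₘ B - f %ₘ A) * W) %ₘ B) := by
  have e := modByMonic_add_div f A
  have e' := modByMonic_add_div f B
  have h₁ : ((f %ₘ B - f %ₘ A) * W) %ₘ B = (f /ₘ A) %ₘ B := by
    refine modByMonic_eq_of_dvd_sub hB ?_
    obtain ⟨V, hV⟩ := hW
    exact ⟨f /ₘ A * V - (f /ₘ B) * W, by linear_combination W * (e' - e) + (f /ₘ A) * hV⟩
  have h₂ : (f /ₘ A) %ₘ B = f /ₘ A := by
    rw [modByMonic_eq_self_iff hB, degree_eq_natDegree hB.ne_zero, ← mem_degreeLT]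
    by_cases h0 : B.natDegree = 0
    · have : f /ₘ A = 0 := by
        rw [divByMonic_eq_zero_iff hA, degree_eq_natDegree hA.ne_zero, ← mem_degreeLT]
        simpa [h0] using hf
      rw [this]
      exact zero_mem _
    · have hlt : (f /ₘ A).natDegree < B.natDegree := by
        rw [natDegree_divByMonic _ hA]
        have : f.natDegree < B.natDegree + A.natDegree := by
          by_cases hf0 : f = 0
          · simp [hf0]; omega
          · exact (natDegree_lt_iff_degree_lt hf0).2 (mem_degreeLT.1 hf)
        omega
      exact degreeLT_mono hlt (mem_degreeLT_natDegree_succ _)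
  rw [h₁, h₂, e]

theorem computes_of_modByMonic {m : ℕ} {c : ℝ} (hM : PolyMulCost F Ω (2 * m) c) (hm : 1 ≤ m)
    {A B : F[X]} (hA : A.Monic) (hAm : A.natDegree = m) (hB : B.Monic) (hBm : B.natDegree = m)
    (hAB : IsCoprime A B) {S : Set (Ω → F)} {f : (Ω → F)[X]} (hf : f ∈ degreeLT (Ω → F) (2 * m))
    (hfA : ∀ i, (f %ₘ A.map (algebraMap F (Ω → F))).coeff i ∈ avail S)
    (hfB : ∀ i, (f %ₘ B.map (algebraMap F (Ω → F))).coeff i ∈ avail S) :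
    Computes S (4 * c + 4 * m) (Set.range f.coeff) := by
  set φ := algebraMap F (Ω → F)
  obtain ⟨U, V, hUV⟩ := hAB
  have hdvd : B ∣ (U %ₘ B) * A - 1 :=
    ⟨-(V + (U /ₘ B) * A), by linear_combination hUV + A * modByMonic_add_div U B⟩
  set W := U %ₘ B
  have hA' := hA.map φ
  have hB' := hB.map φ
  have hAd : (A.map φ).natDegree = m := (hA.natDegree_map _).trans hAm
  have hBd : (B.map φ).natDegree = m := (hB.natDegree_map _).trans hBm
  have e := eq_add_mul_modByMonic (W := W.map φ) hA' hB' (f := f)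
    (by rwa [hAd, hBd, ← two_mul])
    (by simpa using (map_dvd (mapRingHom φ) hdvd))
  have dA := modByMonic_mem_degreeLT f hA'
  have dB := modByMonic_mem_degreeLT f hB'
  rw [hAd] at dA
  rw [hBd] at dB
  have dW : W.map φ ∈ degreeLT (Ω → F) m := map_mem_degreeLT φ (hBm ▸ modByMonic_mem_degreeLT U hB)
  refine ((computes_poly_sub dB dA hfB hfA).bind (c' := c + ((2 * c + m) + (c + (2 * m : ℕ))))
    fun S₁ h₁ hS₁ => ?_).mono_cost (by push_cast; linarith)
  have hle : m ≤ 2 * m := by omega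
  refine (hM S₁ _ (W.map φ) (degreeLT_mono hle (sub_mem dB dA)) (degreeLT_mono hle dW)
    (fun i => hS₁ ⟨i, rfl⟩) (coeff_map_mem_avail S₁ W)).bind fun S₂ h₂ hS₂ => ?_
  refine (computes_modByMonic hM hm hB hBm
    (by rw [two_mul]; exact mul_mem_degreeLT (sub_mem dB dA) dW)
    (fun i => hS₂ ⟨i, rfl⟩)).bind fun S₃ h₃ hS₃ => ?_
  have dR := modByMonic_mem_degreeLT
    ((f %ₘ B.map φ - f %ₘ A.map φ) * W.map φ) hB'
  rw [hBd] at dR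
  have dA' := mem_degreeLT_natDegree_succ (A.map φ)
  rw [hAd] at dA'
  refine (hM S₃ (A.map φ) _ (degreeLT_mono (by omega) dA') (degreeLT_mono hle dR)
    (coeff_map_mem_avail S₃ A) (fun i => hS₃ ⟨i, rfl⟩)).bind fun S₄ h₄ hS₄ => ?_
  rw [e]
  refine computes_poly_add (degreeLT_mono hle dA) ?_
    (fun i => avail_mono (h₁.trans (h₂.trans (h₃.trans h₄))) (hfA i)) (fun i => hS₄ ⟨i, rfl⟩)
  rw [two_mul, mul_comm]
  exact mul_mem_degreeLT_of_succ dR dA'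

theorem modByMonic_treeModulus_mem_degreeLT (n k t : ℕ) (f : (Ω → F)[X]) :
    f %ₘ (treeModulus F n k t).map (algebraMap F (Ω → F)) ∈ degreeLT (Ω → F) (n * 2 ^ k) := by
  have := modByMonic_mem_degreeLT f ((treeModulus_monic n k t).map (algebraMap F (Ω → F)))
  rwa [(treeModulus_monic n k t).natDegree_map, natDegree_treeModulus] at this

/-- Going down the remainder tree: `f` is reduced modulo the two halves of the modulus of a node, and
each of the `k` levels costs `n * 2 ^ k * (2 * κ + 2)`. -/
theorem computes_remainders {n : ℕ} (hn : 1 ≤ n) {κ : ℝ} (k : ℕ)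
    (hM : ∀ j < k, PolyMulCost F Ω (2 * (n * 2 ^ j)) (κ * (n * 2 ^ j))) {S : Set (Ω → F)} (t : ℕ)
    {f : (Ω → F)[X]} (hf : f ∈ degreeLT (Ω → F) (n * 2 ^ k)) (hfS : ∀ i, f.coeff i ∈ avail S) :
    Computes S (k * (n * 2 ^ k) * (2 * κ + 2))
      {g | ∃ s < 2 ^ k, ∃ i, (f %ₘ (X - C ((t + s : ℕ) : Ω → F)) ^ n).coeff i = g} := by
  induction k generalizing S t f with
  | zero =>
    refine .of_subset (by simp) ?_
    rintro _ ⟨s, hs, i, rfl⟩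
    rw [(modByMonic_eq_self_iff ((monic_X_sub_C _).pow _)).2]
    · exact hfS i
    · rw [degree_eq_natDegree ((monic_X_sub_C _).pow _).ne_zero, ← mem_degreeLT,
        (monic_X_sub_C _).natDegree_pow, natDegree_X_sub_C]
      simpa using hf
  | succ k ih =>
    set m := n * 2 ^ k with hm
    have hm1 : 1 ≤ m := Nat.mul_pos hn (by positivity)
    have hf' : f ∈ degreeLT (Ω → F) (2 * m) := by rwa [hm, mul_left_comm, ← pow_succ']
    have hMk : PolyMulCost F Ω (2 * m) (κ * m) := by
      rw [show (m : ℝ) = n * 2 ^ k by simp [hm]]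
      exact hM k k.lt_succ_self
    have key : ∀ t', Computes S (2 * (κ * m) + m)
        (Set.range (f %ₘ (treeModulus F n k t').map (algebraMap F (Ω → F))).coeff) := fun t' =>
      computes_modByMonic hMk hm1 (treeModulus_monic n k t') (natDegree_treeModulus n k t') hf' hfS
    refine (((key t).union (key (t + 2 ^ k))).bind
      (c' := k * m * (2 * κ + 2) + k * m * (2 * κ + 2)) fun S₁ h₁ hS₁ => ?_).mono_cost ?_
    swap
    · have : (m : ℝ) = n * 2 ^ k := by simp [hm]
      have h2 : (0 : ℝ) ≤ m := Nat.cast_nonneg _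
      push_cast
      rw [pow_succ, show (n : ℝ) * (2 ^ k * 2) = 2 * m by rw [this]; ring]
      nlinarith
    rw [Set.union_subset_iff, Set.range_subset_iff, Set.range_subset_iff] at hS₁
    have hM' := fun j (hj : j < k) => hM j (hj.trans k.lt_succ_self)
    have H := (ih hM' t (modByMonic_treeModulus_mem_degreeLT n k t f) hS₁.1).union
      (ih hM' (t + 2 ^ k) (modByMonic_treeModulus_mem_degreeLT n k _ f) hS₁.2)
    refine H.mono_target ?_ |>.mono_cost (by simp [hm])
    rintro _ ⟨s, hs, i, rfl⟩
    refine mem_avail_of_mem ?_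
    rcases lt_or_ge s (2 ^ k) with h | h
    · refine Or.inl ⟨s, h, i, ?_⟩
      rw [modByMonic_treeModulus_modByMonic n k t f h]
    · rw [pow_succ] at hs
      refine Or.inr ⟨s - 2 ^ k, by omega, i, ?_⟩
      rw [modByMonic_treeModulus_modByMonic n k (t + 2 ^ k) f (by omega),
        show t + 2 ^ k + (s - 2 ^ k) = t + s by omega]

/-- Going up the remainder tree: the remainders modulo the two halves of the modulus of a node are
combined by the Chinese remainder theorem. -/
theorem computes_of_remainders [CharZero F] {n : ℕ} (hn : 1 ≤ n) {κ : ℝ} (k : ℕ)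
    (hM : ∀ j < k, PolyMulCost F Ω (2 * (n * 2 ^ j)) (κ * (n * 2 ^ j))) {S : Set (Ω → F)} (t : ℕ)
    {f : (Ω → F)[X]} (hf : f ∈ degreeLT (Ω → F) (n * 2 ^ k))
    (hfS : ∀ s < 2 ^ k, ∀ i, (f %ₘ (X - C ((t + s : ℕ) : Ω → F)) ^ n).coeff i ∈ avail S) :
    Computes S (k * (n * 2 ^ k) * (2 * κ + 2)) (Set.range f.coeff) := by
  induction k generalizing S t f with
  | zero =>
    refine .of_subset (by simp) ?_
    rintro _ ⟨i, rfl⟩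
    have := hfS 0 (by simp) i
    rwa [(modByMonic_eq_self_iff ((monic_X_sub_C _).pow _)).2] at this
    rw [degree_eq_natDegree ((monic_X_sub_C _).pow _).ne_zero, ← mem_degreeLT,
      (monic_X_sub_C _).natDegree_pow, natDegree_X_sub_C]
    simpa using hf
  | succ k ih =>
    set m := n * 2 ^ k with hm
    have hm1 : 1 ≤ m := Nat.mul_pos hn (by positivity)
    have hf' : f ∈ degreeLT (Ω → F) (2 * m) := by rwa [hm, mul_left_comm, ← pow_succ']
    have hMk : PolyMulCost F Ω (2 * m) (κ * m) := by
      rw [show (m : ℝ) = n * 2 ^ k by simp [hm]]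
      exact hM k k.lt_succ_self
    have hM' := fun j (hj : j < k) => hM j (hj.trans k.lt_succ_self)
    have H₁ := ih hM' t (S := S) (modByMonic_treeModulus_mem_degreeLT n k t f) fun s hs i => by
      rw [modByMonic_treeModulus_modByMonic n k t f hs]
      exact hfS s (by rw [pow_succ]; omega) i
    have H₂ := ih hM' (t + 2 ^ k) (S := S)
      (modByMonic_treeModulus_mem_degreeLT n k (t + 2 ^ k) f) fun s hs i => by
      rw [modByMonic_treeModulus_modByMonic n k (t + 2 ^ k) f hs, add_assoc]
      exact hfS (2 ^ k + s) (by rw [pow_succ]; omega) i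
    refine ((H₁.union H₂).bind (c' := 4 * (κ * m) + 4 * m) fun S₁ h₁ hS₁ => ?_).mono_cost ?_
    swap
    · have : (m : ℝ) = n * 2 ^ k := by simp [hm]
      rw [← this]
      push_cast
      rw [pow_succ, show (n : ℝ) * (2 ^ k * 2) = 2 * m by rw [this]; ring]
      linarith
    rw [Set.union_subset_iff, Set.range_subset_iff, Set.range_subset_iff] at hS₁
    exact computes_of_modByMonic hMk hm1 (treeModulus_monic n k t) (natDegree_treeModulus n k t)
      (treeModulus_monic n k _) (natDegree_treeModulus n k _) (isCoprime_treeModulus n k t) hf'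
      hS₁.1 hS₁.2

end SLP

/-! ### Operators as polynomials in `∂` -/

namespace DiffOp

open Polynomial

section Operators

variable {R : Type*} [CommRing R]

/-- The derivation of `R[x][∂]` that differentiates the coefficients in `R[x]`. -/
noncomputable def coeffDeriv : Module.End R R[X][X] :=
  lsum fun j => (monomial j).restrictScalars R ∘ₗ derivative

/-- Left multiplication by `∂` on canonical forms: `∂ ∑ aⱼ ∂ ^ j = ∑ aⱼ' ∂ ^ j + ∑ aⱼ ∂ ^ (j + 1)`.
An operator in canonical form is encoded as a polynomial in `∂` over `R[x]`; the commutative product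
of `R[x][∂]` is not the product of operators. -/
noncomputable def nabla : Module.End R R[X][X] :=
  coeffDeriv + LinearMap.mulLeft R X

/-- The product of operators, `(∑ aⱼ ∂ ^ j) B = ∑ aⱼ (∂ ^ j B)`. -/
noncomputable def opMul (A B : R[X][X]) : R[X][X] :=
  A.sum fun j a => C a * (nabla ^ j) B

theorem coeffDeriv_monomial (j : ℕ) (a : R[X]) :
    coeffDeriv (monomial j a) = monomial j (derivative a) := by
  simp [coeffDeriv, lsum_apply, sum_monomial_index]

theorem coeff_coeffDeriv (P : R[X][X]) (m : ℕ) :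
    (coeffDeriv P).coeff m = derivative (P.coeff m) := by
  induction P using Polynomial.induction_on' with
  | add p q hp hq => simp [hp, hq]
  | monomial j a =>
    rw [coeffDeriv_monomial, coeff_monomial, coeff_monomial]
    split_ifs <;> simp

theorem coeff_coeffDeriv_pow (l : ℕ) (P : R[X][X]) (m : ℕ) :
    ((coeffDeriv ^ l) P).coeff m = derivative^[l] (P.coeff m) := by
  induction l with
  | zero => simp
  | succ l ih => rw [pow_succ', Module.End.mul_apply, coeff_coeffDeriv, ih,
      Function.iterate_succ_apply']

theorem commute_coeffDeriv_mulLeft :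
    Commute (coeffDeriv : Module.End R R[X][X]) (LinearMap.mulLeft R X) := by
  refine LinearMap.ext fun P => Polynomial.ext fun m => ?_
  simp only [Module.End.mul_apply, LinearMap.mulLeft_apply, coeff_coeffDeriv]
  cases m with
  | zero => simp
  | succ m => simp [coeff_coeffDeriv]

theorem nabla_apply (P : R[X][X]) : nabla P = coeffDeriv P + X * P := rfl

theorem nabla_monomial (j : ℕ) (a : R[X]) :
    nabla (monomial j a) = monomial j (derivative a) + monomial (j + 1) a := by
  rw [nabla_apply, coeffDeriv_monomial, X_mul_monomial]

theorem nabla_C_mul (a : R[X]) (P : R[X][X]) :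
    nabla (C a * P) = C (derivative a) * P + C a * nabla P := by
  ext1 m
  cases m with
  | zero => simp [nabla_apply, coeff_coeffDeriv, -derivative_mul, derivative_mul]
  | succ m =>
    simp only [nabla_apply, coeff_add, coeff_coeffDeriv, coeff_C_mul, coeff_X_mul, derivative_mul]
    ring

theorem opMul_add (A A' B : R[X][X]) : opMul (A + A') B = opMul A B + opMul A' B :=
  sum_add_index _ _ _ (by simp) (by simp [add_mul])

theorem opMul_monomial (j : ℕ) (a : R[X]) (B : R[X][X]) :
    opMul (monomial j a) B = C a * (nabla ^ j) B :=
  sum_monomial_index _ _ (by simp)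

theorem nabla_opMul (A B : R[X][X]) : nabla (opMul A B) = opMul (nabla A) B := by
  induction A using Polynomial.induction_on' with
  | add p q hp hq => rw [opMul_add, map_add, hp, hq, map_add, opMul_add]
  | monomial j a =>
    rw [opMul_monomial, nabla_C_mul, nabla_monomial, opMul_add, opMul_monomial, opMul_monomial,
      pow_succ', Module.End.mul_apply]

theorem nabla_pow_opMul (k : ℕ) (A B : R[X][X]) :
    (nabla ^ k) (opMul A B) = opMul ((nabla ^ k) A) B := by
  induction k with
  | zero => simp
  | succ k ih =>
    rw [pow_succ', Module.End.mul_apply, ih, nabla_opMul, Module.End.mul_apply]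

theorem coeff_opMul {A : R[X][X]} {n : ℕ} (hA : A ∈ degreeLT R[X] n) (B : R[X][X]) (m : ℕ) :
    (opMul A B).coeff m = ∑ i ∈ Finset.range n, A.coeff i * ((nabla ^ i) B).coeff m := by
  rw [opMul, sum_over_range' _ (by simp) (max n (A.natDegree + 1)) (by omega),
    finsetSum_coeff]
  simp only [coeff_C_mul]
  refine (Finset.sum_subset (Finset.range_mono (le_max_left _ _)) fun i _ hi => ?_).symm
  rw [(degree_lt_iff_coeff_zero _ _).1 (mem_degreeLT.1 hA) _ (by simpa using hi), zero_mul]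

theorem nabla_pow_mem_degreeLT {P : R[X][X]} {n : ℕ} (hP : P ∈ degreeLT R[X] n) (k : ℕ) :
    (nabla ^ k) P ∈ degreeLT R[X] (n + k) := by
  induction k with
  | zero => simpa using hP
  | succ k ih =>
    rw [pow_succ', Module.End.mul_apply, nabla_apply]
    rw [mem_degreeLT] at ih
    refine mem_degreeLT.2 ((degree_lt_iff_coeff_zero _ _).2 fun i hi => ?_)
    obtain ⟨i, rfl⟩ : ∃ i', i = i' + 1 := ⟨i - 1, by omega⟩
    rw [coeff_add, coeff_coeffDeriv, coeff_X_mul, (degree_lt_iff_coeff_zero _ _).1 ih _ (by omega),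
      (degree_lt_iff_coeff_zero _ _).1 ih _ (by omega)]
    simp

theorem coeff_nabla_pow_mem_degreeLT {P : R[X][X]} {d : ℕ} (hP : ∀ j, P.coeff j ∈ degreeLT R d)
    (k j : ℕ) : ((nabla ^ k) P).coeff j ∈ degreeLT R d := by
  induction k generalizing j with
  | zero => exact hP j
  | succ k ih =>
    rw [pow_succ', Module.End.mul_apply, nabla_apply, coeff_add, coeff_coeffDeriv]
    refine add_mem (mem_degreeLT.2 (degree_derivative_le.trans_lt (mem_degreeLT.1 (ih j)))) ?_
    cases j with
    | zero => simp
    | succ j => simpa using ih j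

theorem coeff_opMul_mem_degreeLT {A B : R[X][X]} {d : ℕ} (hA : ∀ j, A.coeff j ∈ degreeLT R d)
    (hB : ∀ j, B.coeff j ∈ degreeLT R d) (m : ℕ) : (opMul A B).coeff m ∈ degreeLT R (2 * d) := by
  rw [coeff_opMul (SLP.mem_degreeLT_natDegree_succ A), two_mul]
  exact Submodule.sum_mem _ fun i _ =>
    SLP.mul_mem_degreeLT (hA i) (coeff_nabla_pow_mem_degreeLT hB i m)

theorem opMul_mem_degreeLT {A B : R[X][X]} {r : ℕ} (hA : A ∈ degreeLT R[X] r)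
    (hB : B ∈ degreeLT R[X] r) : opMul A B ∈ degreeLT R[X] (2 * r) := by
  refine mem_degreeLT.2 ((degree_lt_iff_coeff_zero _ _).2 fun k hk => ?_)
  rw [coeff_opMul hA]
  refine Finset.sum_eq_zero fun i hi => ?_
  have := Finset.mem_range.1 hi
  rw [(degree_lt_iff_coeff_zero _ _).1 (mem_degreeLT.1 (nabla_pow_mem_degreeLT hB i)) k (by omega),
    mul_zero]

/-- The binomial expansion of `∂ ^ k P`. -/
theorem coeff_nabla_pow (k : ℕ) (P : R[X][X]) (m : ℕ) :
    ((nabla ^ k) P).coeff m = ∑ l ∈ Finset.range (k + 1),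
      (k.choose l : R[X]) * if k ≤ m + l then derivative^[l] (P.coeff (m + l - k)) else 0 := by
  rw [nabla, commute_coeffDeriv_mulLeft.add_pow, LinearMap.sum_apply, finsetSum_coeff]
  refine Finset.sum_congr rfl fun l hl => ?_
  have hl := Finset.mem_range.1 hl
  rw [Module.End.mul_apply, Module.End.mul_apply, Module.End.natCast_apply, map_nsmul, map_nsmul,
    coeff_smul, nsmul_eq_mul, coeff_coeffDeriv_pow, LinearMap.pow_mulLeft, LinearMap.mulLeft_apply,
    coeff_X_pow_mul']
  by_cases h : k ≤ m + l
  · rw [if_pos h, if_pos (by omega), show m - (k - l) = m + l - k by omega]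
  · rw [if_neg h, if_neg (by omega), iterate_derivative_zero]

/-- The binomial expansion of `(∂ - Y) ^ l`, where `Y` multiplies by the variable `∂` on canonical
forms: it recovers the derivatives of the coefficients of `P` from the operators `∂ ^ k P`. -/
theorem iterate_derivative_coeff (l : ℕ) (P : R[X][X]) (j : ℕ) :
    derivative^[l] (P.coeff j) = ∑ k ∈ Finset.range (l + 1),
      ((-1) ^ (l - k) * l.choose k : R[X]) *
        if l ≤ j + k then ((nabla ^ k) P).coeff (j + k - l) else 0 := by
  have hX (P : R[X][X]) : nabla (X * P) = X * nabla P := by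
    have := LinearMap.congr_fun (commute_coeffDeriv_mulLeft (R := R)).eq P
    simp only [Module.End.mul_apply, LinearMap.mulLeft_apply] at this
    rw [nabla_apply, this, nabla_apply, mul_add]
  have hc : Commute (nabla : Module.End R R[X][X]) (LinearMap.mulLeft R (C (-1) * X)) := by
    refine LinearMap.ext fun P => ?_
    simp only [Module.End.mul_apply, LinearMap.mulLeft_apply]
    rw [mul_assoc, nabla_C_mul, hX, derivative_neg, derivative_one]
    simp [mul_assoc]
  have hs : (coeffDeriv : Module.End R R[X][X]) = nabla + LinearMap.mulLeft R (C (-1) * X) := by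
    refine LinearMap.ext fun P => Polynomial.ext fun m => ?_
    rw [LinearMap.add_apply, LinearMap.mulLeft_apply, nabla_apply, mul_assoc, coeff_add, coeff_add,
      coeff_C_mul]
    ring
  rw [← coeff_coeffDeriv_pow, hs, hc.add_pow, LinearMap.sum_apply, finsetSum_coeff]
  refine Finset.sum_congr rfl fun k hk => ?_
  have hk := Finset.mem_range.1 hk
  rw [(hc.pow_pow _ _).eq, Module.End.mul_apply, Module.End.mul_apply, Module.End.natCast_apply,
    map_nsmul, map_nsmul, coeff_smul, nsmul_eq_mul, LinearMap.pow_mulLeft, LinearMap.mulLeft_apply,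
    mul_pow, ← C_pow, mul_assoc (C _), coeff_C_mul, coeff_X_pow_mul', mul_left_comm,
    ← mul_assoc]
  congr 1
  by_cases h : l ≤ j + k
  · rw [if_pos h, if_pos (by omega), show j - (l - k) = j + k - l by omega]
  · rw [if_neg h, if_neg (by omega)]

theorem eval_iterate_derivative (α : R) (p : R[X]) (l : ℕ) :
    (derivative^[l] p).eval α = l.factorial * (taylor α p).coeff l := by
  rw [taylor_coeff, ← factorial_smul_hasseDeriv]
  simp

/-- The base change of operators along `φ`. -/
noncomputable def mapOp {R' : Type*} [CommRing R'] (φ : R →+* R') : R[X][X] →+* R'[X][X] :=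
  mapRingHom (mapRingHom φ)

theorem mapOp_nabla {R' : Type*} [CommRing R'] (φ : R →+* R') (P : R[X][X]) :
    mapOp φ (nabla P) = nabla (mapOp φ P) := by
  induction P using Polynomial.induction_on' with
  | add p q hp hq => simp only [map_add, hp, hq]
  | monomial j a => simp [nabla_monomial, mapOp, derivative_map]

theorem mapOp_nabla_pow {R' : Type*} [CommRing R'] (φ : R →+* R') (P : R[X][X]) (k : ℕ) :
    mapOp φ ((nabla ^ k) P) = (nabla ^ k) (mapOp φ P) := by
  induction k with
  | zero => simp
  | succ k ih => rw [pow_succ', Module.End.mul_apply, mapOp_nabla, ih, pow_succ',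
      Module.End.mul_apply]

theorem mapOp_opMul {R' : Type*} [CommRing R'] (φ : R →+* R') (A B : R[X][X]) :
    mapOp φ (opMul A B) = opMul (mapOp φ A) (mapOp φ B) := by
  induction A using Polynomial.induction_on' with
  | add p q hp hq => simp only [map_add, opMul_add, hp, hq]
  | monomial j a =>
    rw [opMul_monomial, map_mul, mapOp_nabla_pow]
    simp [mapOp, opMul_monomial]

/-- The canonical form with the coefficients `a`. -/
noncomputable def opPoly {m n : ℕ} (a : Fin m × Fin n → R) : R[X][X] :=
  ∑ p : Fin m × Fin n, monomial (p.2 : ℕ) (monomial (p.1 : ℕ) (a p))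

theorem coeff_coeff_opPoly {m n : ℕ} (a : Fin m × Fin n → R) (i j : ℕ) :
    ((opPoly a).coeff j).coeff i =
      if h : i < m ∧ j < n then a (⟨i, h.1⟩, ⟨j, h.2⟩) else 0 := by
  rw [opPoly, finsetSum_coeff, finsetSum_coeff]
  simp only [coeff_monomial]
  split_ifs with h
  · rw [Finset.sum_eq_single (⟨i, h.1⟩, ⟨j, h.2⟩)]
    · simp
    · rintro ⟨⟨i', hi⟩, ⟨j', hj⟩⟩ _ hne
      simp only [ne_eq, Prod.mk.injEq, Fin.mk.injEq, not_and_or] at hne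
      dsimp only
      split_ifs with h₁
      · rw [coeff_monomial, if_neg (by omega)]
      · simp
    · simp
  · refine Finset.sum_eq_zero ?_
    rintro ⟨⟨i', hi⟩, ⟨j', hj⟩⟩ _
    dsimp only
    split_ifs with h₁
    · rw [coeff_monomial, if_neg (by omega)]
    · simp

theorem opPoly_mem_degreeLT {m n : ℕ} (a : Fin m × Fin n → R) : opPoly a ∈ degreeLT R[X] n := by
  refine mem_degreeLT.2 ((degree_lt_iff_coeff_zero _ _).2 fun j hj => ?_)
  ext i
  rw [coeff_coeff_opPoly, dif_neg (by omega), coeff_zero]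

theorem coeff_opPoly_mem_degreeLT {m n : ℕ} (a : Fin m × Fin n → R) (j : ℕ) :
    (opPoly a).coeff j ∈ degreeLT R m := by
  refine mem_degreeLT.2 ((degree_lt_iff_coeff_zero _ _).2 fun i hi => ?_)
  rw [coeff_coeff_opPoly, dif_neg (by omega)]

theorem opPoly_coeff {m n : ℕ} {P : R[X][X]} (hP : P ∈ degreeLT R[X] n)
    (hP' : ∀ j, P.coeff j ∈ degreeLT R m) :
    opPoly (fun p : Fin m × Fin n => (P.coeff p.2).coeff p.1) = P := by
  ext j i
  rw [coeff_coeff_opPoly]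
  split_ifs with h
  · rfl
  · rcases not_and_or.1 h with h | h
    · rw [(degree_lt_iff_coeff_zero _ _).1 (mem_degreeLT.1 (hP' j)) _ (not_lt.1 h)]
    · rw [(degree_lt_iff_coeff_zero _ _).1 (mem_degreeLT.1 hP) _ (not_lt.1 h), coeff_zero]

theorem mapOp_opPoly {R' : Type*} [CommRing R'] (φ : R →+* R') {m n : ℕ} (a : Fin m × Fin n → R) :
    mapOp φ (opPoly a) = opPoly fun p => φ (a p) := by
  simp [mapOp, opPoly]

end Operators

variable {F : Type*} [Field F]

theorem d_mul_x : d F * x F = x F * d F + 1 := by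
  have := RingQuot.mkAlgHom_rel F (Rel.comm (F := F))
  simpa [d, x] using this

theorem d_mul_aeval_x (p : F[X]) :
    d F * aeval (x F) p = aeval (x F) p * d F + aeval (x F) (derivative p) := by
  induction p using Polynomial.induction_on with
  | C a => simp [Algebra.commutes]
  | add p q hp hq => simp only [map_add, mul_add, add_mul, hp, hq]; abel
  | monomial n a h =>
    have e : (C a * X ^ (n + 1) : F[X]) = C a * X ^ n * X := by rw [pow_succ, mul_assoc]
    rw [e]
    generalize (C a * X ^ n : F[X]) = p at h ⊢
    rw [derivative_mul, derivative_X, map_mul, aeval_X, ← mul_assoc, h, add_mul, mul_assoc, d_mul_x,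
      map_add, map_mul, map_mul, aeval_X, map_one]
    noncomm_ring

/-- The operator with a given canonical form. -/
noncomputable def ofPoly : F[X][X] →ₗ[F] DiffOp F :=
  lsum fun j => LinearMap.mulRight F (d F ^ j) ∘ₗ (aeval (x F)).toLinearMap

theorem ofPoly_monomial (j : ℕ) (a : F[X]) :
    ofPoly (monomial j a) = aeval (x F) a * d F ^ j := by
  simp [ofPoly, lsum_apply, sum_monomial_index]

theorem ofPoly_C_mul (a : F[X]) (P : F[X][X]) : ofPoly (C a * P) = aeval (x F) a * ofPoly P := by
  induction P using Polynomial.induction_on' with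
  | add p q hp hq => rw [mul_add, map_add, hp, hq, map_add, mul_add]
  | monomial j b => rw [C_mul_monomial, ofPoly_monomial, ofPoly_monomial, map_mul, mul_assoc]

theorem ofPoly_nabla (P : F[X][X]) : ofPoly (nabla P) = d F * ofPoly P := by
  induction P using Polynomial.induction_on' with
  | add p q hp hq => simp only [map_add, mul_add, hp, hq]
  | monomial j a =>
    rw [nabla_monomial, map_add, ofPoly_monomial, ofPoly_monomial, ofPoly_monomial, ← mul_assoc,
      d_mul_aeval_x, add_mul, pow_succ', mul_assoc, add_comm]

theorem ofPoly_nabla_pow (k : ℕ) (P : F[X][X]) : ofPoly ((nabla ^ k) P) = d F ^ k * ofPoly P := by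
  induction k with
  | zero => simp
  | succ k ih => rw [pow_succ', Module.End.mul_apply, ofPoly_nabla, ih, pow_succ', mul_assoc]

theorem ofPoly_opMul (A B : F[X][X]) : ofPoly (opMul A B) = ofPoly A * ofPoly B := by
  induction A using Polynomial.induction_on' with
  | add p q hp hq => rw [opMul_add, map_add, hp, hq, map_add, add_mul]
  | monomial j a => rw [opMul_monomial, ofPoly_C_mul, ofPoly_nabla_pow, ofPoly_monomial, mul_assoc]

theorem ofPoly_opPoly {m n : ℕ} (a : Fin m × Fin n → F) : ofPoly (opPoly a) = ofCoeffs a := by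
  simp only [opPoly, map_sum, ofPoly_monomial, aeval_monomial, ofCoeffs, Algebra.smul_def,
    mul_assoc]

end DiffOp

/-! ### The product at one point -/

namespace SLP

open Polynomial DiffOp

theorem coeff_taylor_modByMonic {R : Type*} [CommRing R] (α : R) (f : R[X]) {n l : ℕ} (hl : l < n) :
    (taylor α (f %ₘ (X - C α) ^ n)).coeff l = (taylor α f).coeff l := by
  conv_rhs => rw [← modByMonic_add_div f ((X - C α) ^ n)]
  rw [map_add, taylor_mul, taylor_pow, map_sub, taylor_X, taylor_C, add_sub_cancel_right, coeff_add,
    coeff_X_pow_mul', if_neg (by omega), add_zero]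

theorem modByMonic_X_sub_C_pow_mem_degreeLT {R : Type*} [CommRing R] [Nontrivial R] (α : R)
    (f : R[X]) (n : ℕ) : f %ₘ (X - C α) ^ n ∈ degreeLT R n := by
  have := modByMonic_mem_degreeLT f ((monic_X_sub_C α).pow n)
  rwa [(monic_X_sub_C α).natDegree_pow, natDegree_X_sub_C, mul_one] at this

theorem taylor_mem_degreeLT {R : Type*} [CommRing R] (α : R) {f : R[X]} {n : ℕ}
    (hf : f ∈ degreeLT R n) : taylor α f ∈ degreeLT R n := by
  rw [mem_degreeLT] at *
  rwa [degree_taylor]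

variable {F Ω : Type*} [Field F] {N : ℕ} {c : ℝ} {S : Set (Ω → F)} {α : Ω → F}

/-- Taylor shifts of `N` polynomials of degree less than `N`, by one matrix multiplication. -/
theorem computes_taylor (hM : MatMulCost F Ω N c) (hα : α ∈ Set.range (algebraMap F (Ω → F)))
    {f : ℕ → (Ω → F)[X]} (hf : ∀ j < N, f j ∈ degreeLT (Ω → F) N)
    (hfS : ∀ j < N, ∀ i, (f j).coeff i ∈ avail S) :
    Computes S c {g | ∃ j < N, ∃ i < N, (taylor α (f j)).coeff i = g} := by
  obtain ⟨β, rfl⟩ := hα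
  refine (hM S (fun j l => (f j).coeff l)
    (fun l i => (taylor (algebraMap F (Ω → F) β) (X ^ l)).coeff i)
    (fun j hj l _ => hfS j hj l) fun l _ i _ => ?_).mono_target ?_
  · have := coeff_map_mem_avail S (taylor β (X ^ l)) i
    rwa [map_taylor, Polynomial.map_pow, map_X] at this
  · rintro _ ⟨j, hj, i, hi, rfl⟩
    refine mem_avail_of_mem ⟨j, hj, i, hi, ?_⟩
    have h0 : f j = ∑ l ∈ Finset.range N, C ((f j).coeff l) * X ^ l := by
      ext1 k
      simp only [finsetSum_coeff, coeff_C_mul_X_pow, Finset.sum_ite_eq, Finset.mem_range]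
      split_ifs with hk
      · rfl
      · exact (degree_lt_iff_coeff_zero _ _).1 (mem_degreeLT.1 (hf j hj)) k (not_lt.1 hk)
    conv_rhs => rw [h0, map_sum, finsetSum_coeff]
    simp only [taylor_mul, taylor_C, coeff_C_mul]

/-- From the Taylor coefficients of `P` at `α` up to order `s` to the coefficients at `x = α` of the
operators `∂ ^ k P` for `k < s`. Row `l` of the Taylor data is shifted by `l`, which turns the
binomial expansion of `∂ ^ k P` into a product with one fixed matrix. -/
theorem computes_eval_nabla_pow (hM : MatMulCost F Ω N c) {s w : ℕ} (hw : w + s ≤ N)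
    {P : (Ω → F)[X][X]} (hP : ∀ j, ∀ l < s, (taylor α (P.coeff j)).coeff l ∈ avail S) :
    Computes S c {g | ∃ k < s, ∃ m < w, (((nabla ^ k) P).coeff m).eval α = g} := by
  refine (hM S (fun k l => algebraMap F (Ω → F) (k.choose l * l.factorial))
    (fun l i => if l < s ∧ s ≤ i + l then (taylor α (P.coeff (i + l - s))).coeff l else 0)
    (fun _ _ _ _ => const_mem_avail _ _) fun l _ i _ => ?_).mono_target ?_
  · split_ifs with h
    · exact hP _ _ h.1
    · exact zero_mem_avail _
  · rintro _ ⟨k, hk, m, hm, rfl⟩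
    refine mem_avail_of_mem ⟨k, by omega, m + s - k, by omega, ?_⟩
    rw [coeff_nabla_pow, eval_finsetSum]
    refine (Finset.sum_subset (Finset.range_mono (show k + 1 ≤ N by omega))
      fun l _ hl => ?_).symm.trans ?_
    · rw [Nat.choose_eq_zero_of_lt (by simpa using hl)]
      simp
    · refine Finset.sum_congr rfl fun l hl => ?_
      have hl := Finset.mem_range.1 hl
      by_cases h : k ≤ m + l
      · rw [if_pos (by omega), if_pos h, eval_mul, eval_iterate_derivative, eval_natCast,
          show m + s - k + l - s = m + l - k by omega]
        simp [mul_assoc]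
      · rw [if_neg (by omega), if_neg h]
        simp

/-- As `∂ ^ k (A B) = (∂ ^ k A) B`, evaluation at `x = α` turns the product of operators into a
product of matrices. The operator `∂ ^ k A` has order less than `s` in the rows `k < t` that are
computed, so `s` rows for `B` suffice. -/
theorem computes_eval_nabla_pow_opMul (hM : MatMulCost F Ω N c) {r s t w : ℕ} (hs : r + t ≤ s)
    (hsw : s ≤ w) (hw : w ≤ N) {A B : (Ω → F)[X][X]} (hA : A ∈ degreeLT (Ω → F)[X] r)
    (hAS : ∀ k < s, ∀ m < w, (((nabla ^ k) A).coeff m).eval α ∈ avail S)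
    (hBS : ∀ k < s, ∀ m < w, (((nabla ^ k) B).coeff m).eval α ∈ avail S) :
    Computes S c {g | ∃ k < t, ∃ m < w, (((nabla ^ k) (opMul A B)).coeff m).eval α = g} := by
  refine (hM S (fun k i => if k < s ∧ i < s then (((nabla ^ k) A).coeff i).eval α else 0)
    (fun i m => if i < s ∧ m < w then (((nabla ^ i) B).coeff m).eval α else 0)
    (fun k _ i _ => ?_) fun i _ m _ => ?_).mono_target ?_
  · split_ifs with h
    · exact hAS _ h.1 _ (by omega)
    · exact zero_mem_avail _
  · split_ifs with h
    · exact hBS _ h.1 _ h.2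
    · exact zero_mem_avail _
  · rintro _ ⟨k, hk, m, hm, rfl⟩
    refine mem_avail_of_mem ⟨k, by omega, m, by omega, ?_⟩
    rw [nabla_pow_opMul, coeff_opMul (degreeLT_mono (by omega) (nabla_pow_mem_degreeLT hA k) :
      _ ∈ degreeLT (Ω → F)[X] s), eval_finsetSum]
    refine (Finset.sum_subset (Finset.range_mono (show s ≤ N by omega))
      fun l _ hl => ?_).symm.trans ?_
    · rw [if_neg (by simp at hl; omega), zero_mul]
    · refine Finset.sum_congr rfl fun l hl => ?_
      have hl := Finset.mem_range.1 hl
      rw [if_pos ⟨by omega, hl⟩, if_pos ⟨hl, hm⟩, eval_mul]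

/-- The inverse of `computes_eval_nabla_pow`. -/
theorem computes_taylor_of_eval_nabla_pow [CharZero F] (hM : MatMulCost F Ω N c) {s w : ℕ}
    (hw : w + s ≤ N) {P : (Ω → F)[X][X]}
    (hP : ∀ k < s, ∀ m < w, (((nabla ^ k) P).coeff m).eval α ∈ avail S) :
    Computes S c {g | ∃ l < s, ∃ j < w, (taylor α (P.coeff j)).coeff l = g} := by
  refine (hM S
    (fun l k => algebraMap F (Ω → F) ((l.factorial : F)⁻¹ * ((-1) ^ (l - k) * l.choose k)))
    (fun k i => if k < s ∧ s ≤ i + k ∧ i + k - s < w then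
      (((nabla ^ k) P).coeff (i + k - s)).eval α else 0)
    (fun _ _ _ _ => const_mem_avail _ _) fun k _ i _ => ?_).mono_target ?_
  · split_ifs with h
    · exact hP _ h.1 _ h.2.2
    · exact zero_mem_avail _
  · rintro _ ⟨l, hl, j, hj, rfl⟩
    refine mem_avail_of_mem ⟨l, by omega, j + s - l, by omega, ?_⟩
    have hne : (l.factorial : F) ≠ 0 := Nat.cast_ne_zero.2 l.factorial_ne_zero
    have hT : (taylor α (P.coeff j)).coeff l =
        algebraMap F (Ω → F) (l.factorial : F)⁻¹ * (derivative^[l] (P.coeff j)).eval α := by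
      rw [eval_iterate_derivative, ← mul_assoc, ← map_natCast (algebraMap F (Ω → F)), ← map_mul,
        inv_mul_cancel₀ hne, map_one, one_mul]
    rw [hT, iterate_derivative_coeff, eval_finsetSum, Finset.mul_sum]
    refine (Finset.sum_subset (Finset.range_mono (show l + 1 ≤ N by omega))
      fun k _ hk => ?_).symm.trans ?_
    · rw [Nat.choose_eq_zero_of_lt (by simpa using hk)]
      simp
    · refine Finset.sum_congr rfl fun k hk => ?_
      have hk := Finset.mem_range.1 hk
      by_cases h : l ≤ j + k
      · rw [if_pos (by omega), if_pos h, eval_mul, show j + s - l + k - s = j + k - l by omega,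
          map_mul, mul_assoc]
        simp
      · rw [if_neg (by omega), if_neg h]
        simp

/-- From `A` and `B` modulo `(x - α) ^ (2 r)` to the product of operators modulo `(x - α) ^ r`. The
first `r` rows of the matrix of `A` reach the columns below `2 r`, so `2 r` rows are needed for `B`;
these reach the columns below `3 r`, and the shifts by up to `2 r` bring the size to `5 r`. -/
theorem computes_opMul_modByMonic [CharZero F] [Nonempty Ω] {r : ℕ}
    (hM : MatMulCost F Ω (5 * r) c) (hα : α ∈ Set.range (algebraMap F (Ω → F)))
    {A B : (Ω → F)[X][X]} (hA : A ∈ degreeLT (Ω → F)[X] r) (hB : B ∈ degreeLT (Ω → F)[X] r)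
    (hAS : ∀ j < r, ∀ i, (A.coeff j %ₘ (X - C α) ^ (2 * r)).coeff i ∈ avail S)
    (hBS : ∀ j < r, ∀ i, (B.coeff j %ₘ (X - C α) ^ (2 * r)).coeff i ∈ avail S) :
    Computes S (7 * c)
      {g | ∃ j < 2 * r, ∃ i, ((opMul A B).coeff j %ₘ (X - C α) ^ r).coeff i = g} := by
  have taylorData : ∀ {P : (Ω → F)[X][X]}, P ∈ degreeLT (Ω → F)[X] r →
      (∀ j < r, ∀ i, (P.coeff j %ₘ (X - C α) ^ (2 * r)).coeff i ∈ avail S) →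
      Computes S c {g | ∃ j, ∃ l < 2 * r, (taylor α (P.coeff j)).coeff l = g} := by
    intro P hP hPS
    have hz : ∀ j, r ≤ j → P.coeff j = 0 := (degree_lt_iff_coeff_zero _ _).1 (mem_degreeLT.1 hP)
    refine (computes_taylor hM hα (f := fun j => P.coeff j %ₘ (X - C α) ^ (2 * r))
      (fun j _ => degreeLT_mono (by omega) (modByMonic_X_sub_C_pow_mem_degreeLT _ _ _))
      (fun j _ i => ?_)).mono_target ?_
    · rcases lt_or_ge j r with h | h
      · exact hPS j h i
      · rw [hz j h, zero_modByMonic]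
        exact zero_mem_avail _
    · rintro _ ⟨j, l, hl, rfl⟩
      rcases lt_or_ge j r with h | h
      · exact mem_avail_of_mem ⟨j, by omega, l, by omega, coeff_taylor_modByMonic α _ hl⟩
      · rw [hz j h, map_zero]
        exact zero_mem_avail _
  refine ((taylorData hA hAS).union (taylorData hB hBS)).bind
    (c' := (c + c) + (c + (c + c))) (fun S₁ _ hS₁ => ?_) |>.mono_cost (by linarith)
  rw [Set.union_subset_iff] at hS₁
  refine ((computes_eval_nabla_pow hM (s := 2 * r) (w := 3 * r) (by omega)
    fun j l hl => hS₁.1 ⟨j, l, hl, rfl⟩).union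
    (computes_eval_nabla_pow hM (s := 2 * r) (w := 3 * r) (by omega)
    fun j l hl => hS₁.2 ⟨j, l, hl, rfl⟩)).bind fun S₂ _ hS₂ => ?_
  rw [Set.union_subset_iff] at hS₂
  refine (computes_eval_nabla_pow_opMul hM (r := r) (s := 2 * r) (t := r) (w := 3 * r) (by omega)
    (by omega) (by omega) hA (fun k hk m hm => hS₂.1 ⟨k, hk, m, hm, rfl⟩)
    (fun k hk m hm => hS₂.2 ⟨k, hk, m, hm, rfl⟩)).bind fun S₃ _ hS₃ => ?_
  refine (computes_taylor_of_eval_nabla_pow hM (s := r) (w := 3 * r) (by omega)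
    fun k hk m hm => hS₃ ⟨k, hk, m, hm, rfl⟩).bind fun S₄ _ hS₄ => ?_
  set P := opMul A B
  have hP : ∀ j, 2 * r ≤ j → P.coeff j = 0 :=
    (degree_lt_iff_coeff_zero _ _).1 (mem_degreeLT.1 (opMul_mem_degreeLT hA hB))
  have hα' : -α ∈ Set.range (algebraMap F (Ω → F)) := by
    obtain ⟨β, rfl⟩ := hα
    exact ⟨-β, map_neg _ _⟩
  have hdeg : ∀ j, taylor α (P.coeff j %ₘ (X - C α) ^ r) ∈ degreeLT (Ω → F) r := fun j =>
    taylor_mem_degreeLT α (modByMonic_X_sub_C_pow_mem_degreeLT _ _ _)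
  refine (computes_taylor hM hα' (f := fun j => taylor α (P.coeff j %ₘ (X - C α) ^ r))
    (fun j _ => degreeLT_mono (by omega) (hdeg j)) (fun j _ i => ?_)).mono_target ?_
  · rcases lt_or_ge i r with hi | hi
    · rw [coeff_taylor_modByMonic α _ hi]
      rcases lt_or_ge j (2 * r) with hj | hj
      · exact hS₄ ⟨i, hi, j, by omega, rfl⟩
      · rw [hP j hj, map_zero]
        exact zero_mem_avail _
    · rw [(degree_lt_iff_coeff_zero _ _).1 (mem_degreeLT.1 (hdeg j)) i hi]
      exact zero_mem_avail _
  · rintro _ ⟨j, hj, i, rfl⟩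
    rcases lt_or_ge i r with hi | hi
    · refine mem_avail_of_mem ⟨j, by omega, i, by omega, ?_⟩
      rw [taylor_taylor, neg_add_cancel, taylor_zero]
    · rw [(degree_lt_iff_coeff_zero _ _).1
        (mem_degreeLT.1 (modByMonic_X_sub_C_pow_mem_degreeLT α _ r)) i hi]
      exact zero_mem_avail _

/-! ### The product of operators -/

/-- Evaluation at `2 ^ h` points, products at each point, and interpolation. -/
theorem computes_opMul [CharZero F] [Nonempty Ω] {d r h : ℕ} (hr : 1 ≤ r) (hd : 2 * d ≤ r * 2 ^ h)
    {κ : ℝ} (hM : MatMulCost F Ω (5 * r) c)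
    (hpoly : ∀ m, 1 ≤ m → m ≤ 2 * (r * 2 ^ h) → PolyMulCost F Ω m (κ * m))
    {A B : (Ω → F)[X][X]} (hA : A ∈ degreeLT (Ω → F)[X] r) (hB : B ∈ degreeLT (Ω → F)[X] r)
    (hA' : ∀ j, A.coeff j ∈ degreeLT (Ω → F) d) (hB' : ∀ j, B.coeff j ∈ degreeLT (Ω → F) d)
    (hAS : ∀ j i, (A.coeff j).coeff i ∈ avail S) (hBS : ∀ j i, (B.coeff j).coeff i ∈ avail S) :
    Computes S (6 * r * (h * (r * 2 ^ h) * (4 * κ + 2)) + 2 ^ h * (7 * c))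
      {g | ∃ j < 2 * r, ∃ i, ((opMul A B).coeff j).coeff i = g} := by
  have hM' : ∀ n, 1 ≤ n → n ≤ 2 * r → ∀ j < h,
      PolyMulCost F Ω (2 * (n * 2 ^ j)) (2 * κ * (n * 2 ^ j)) := by
    intro n hn hnr j hj
    have hj' : 2 * 2 ^ j ≤ 2 ^ h := by
      rw [← pow_succ']
      exact Nat.pow_le_pow_right two_pos hj
    have h1 : 1 ≤ n * 2 ^ j := Nat.mul_pos hn (by positivity)
    have h2 : n * (2 * 2 ^ j) ≤ 2 * r * 2 ^ h := Nat.mul_le_mul hnr hj'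
    refine (hpoly (2 * (n * 2 ^ j)) (by omega) ?_).mono le_rfl ?_
    · linarith
    · push_cast
      linarith
  have down : ∀ {P : (Ω → F)[X][X]}, (∀ j, P.coeff j ∈ degreeLT (Ω → F) d) →
      (∀ j i, (P.coeff j).coeff i ∈ avail S) →
      Computes S (r * (h * ((2 * r : ℕ) * 2 ^ h) * (2 * (2 * κ) + 2)))
        {g | ∃ j < r, ∃ s < 2 ^ h, ∃ i,
          (P.coeff j %ₘ (X - C ((0 + s : ℕ) : Ω → F)) ^ (2 * r)).coeff i = g} := by
    intro P hP hPS
    refine Computes.forall_lt fun j _ => computes_remainders (n := 2 * r) (by omega) h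
      (hM' _ (by omega) le_rfl) 0 (degreeLT_mono ?_ (hP j)) (hPS j)
    linarith
  refine (((down hA' hAS).union (down hB' hBS)).bind
    (c' := (2 ^ h : ℕ) * (7 * c) + (2 * r : ℕ) * (h * (r * 2 ^ h) * (2 * (2 * κ) + 2)))
    fun S₁ _ hS₁ => ?_).mono_cost (by push_cast; linarith)
  rw [Set.union_subset_iff] at hS₁
  refine (Computes.forall_lt fun s hs => computes_opMul_modByMonic hM
    (α := ((0 + s : ℕ) : Ω → F)) ⟨((0 + s : ℕ) : F), map_natCast _ _⟩ hA hB
    (fun j hj i => hS₁.1 ⟨j, hj, s, hs, i, rfl⟩)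
    (fun j hj i => hS₁.2 ⟨j, hj, s, hs, i, rfl⟩)).bind fun S₂ _ hS₂ => ?_
  refine Computes.forall_lt_coeff fun j hj => computes_of_remainders hr h (hM' r hr (by omega)) 0
    (degreeLT_mono hd (coeff_opMul_mem_degreeLT hA' hB' j))
    fun s hs i => hS₂ ⟨s, hs, j, hj, i, rfl⟩

end SLP

/-! ### Choice of the parameters -/

/-- Linear costs are dominated by those of a polynomial product, because `1 ≤ M(1)`. -/
theorem IsPolyMulTime.le {F : Type*} [Field F] {M : ℕ → ℝ} (hM : IsPolyMulTime F M)
    (hMmono : ∀ m n : ℕ, 1 ≤ m → m ≤ n → M m / (m : ℝ) ≤ M n / (n : ℝ)) {d : ℕ} (hd : 1 ≤ d) :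
    (d : ℝ) ≤ M d := by
  obtain ⟨P, hP, hmul⟩ := hM 1 le_rfl
  have h1 : (1 : ℝ) ≤ M 1 :=
    le_trans (by exact_mod_cast SLP.one_le_cost_of_multipliesPolys hmul) hP
  have h2 := hMmono 1 d le_rfl hd
  rw [Nat.cast_one, div_one, le_div_iff₀ (by positivity)] at h2
  nlinarith [(Nat.cast_nonneg d : (0 : ℝ) ≤ d)]

/-- Up to degree `8 d`, polynomials of degree less than `m` can be multiplied within
`O(m M(d) / d)` operations. -/
theorem IsPolyMulTime.polyMulCost {F Ω : Type*} [Field F] [Nonempty Ω] {M : ℕ → ℝ}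
    (hM : IsPolyMulTime F M)
    (hMmono : ∀ m n : ℕ, 1 ≤ m → m ≤ n → M m / (m : ℝ) ≤ M n / (n : ℝ)) {d m : ℕ} (hm : 1 ≤ m)
    (hmd : m ≤ 8 * d) : SLP.PolyMulCost F Ω m (400 * (M d / d) * m) := by
  have hd : 1 ≤ d := by omega
  have hdpos : (0 : ℝ) < d := by exact_mod_cast hd
  have hdM := hM.le hMmono hd
  have hmpos : (0 : ℝ) < m := by exact_mod_cast hm
  have base : ∀ n, 1 ≤ n → SLP.PolyMulCost F Ω n (M n) := fun n hn => by
    obtain ⟨P, hP, hmul⟩ := hM n hn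
    exact (SLP.polyMulCost_of_program hmul).mono le_rfl hP
  -- Beyond `d` the hypothesis on `M` bounds nothing from above: multiply by blocks of size `d`.
  rcases le_total m d with h | h
  · refine (base m hm).mono le_rfl ?_
    have h2 := hMmono m d hm h
    rw [div_le_iff₀ hmpos] at h2
    have hM0 : 0 ≤ M d := hdpos.le.trans hdM
    have : 0 ≤ M d / d * m := by positivity
    linarith
  · refine ((base d hd).double.double.double).mono (by omega) ?_
    have h2 : M d ≤ M d / d * m := by
      rw [div_mul_eq_mul_div, le_div_iff₀ hdpos]
      exact mul_le_mul_of_nonneg_left (by exact_mod_cast h) (by linarith)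
    push_cast
    linarith

/-- The number of points: `r * 2 ^ h` lies between `2 d` and `4 d`, and `h = O(log d)`. -/
theorem exists_pow_two_between {d r : ℕ} (hr : 1 ≤ r) (hrd : r < d) :
    ∃ h : ℕ, 2 * d ≤ r * 2 ^ h ∧ r * 2 ^ h ≤ 4 * d ∧ (h : ℝ) ≤ 6 * Real.log d := by
  have hex : ∃ h : ℕ, 2 * d ≤ r * 2 ^ h := by
    refine ⟨2 * d, ?_⟩
    exact (Nat.lt_two_pow_self (n := 2 * d)).le.trans (Nat.le_mul_of_pos_left _ hr)
  have hspec := Nat.find_spec hex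
  set h := Nat.find hex
  have hh : h ≠ 0 := fun h0 => by
    rw [h0] at hspec
    omega
  obtain ⟨k, hk⟩ := Nat.exists_eq_succ_of_ne_zero hh
  have hmin := Nat.find_min hex (show k < h by omega)
  have hup : r * 2 ^ h ≤ 4 * d := by
    rw [hk, Nat.succ_eq_add_one, pow_succ, ← mul_assoc]
    omega
  refine ⟨h, hspec, hup, ?_⟩
  have hd2 : (2 : ℝ) ≤ d := by exact_mod_cast (by omega : 2 ≤ d)
  have h3 : (2 : ℝ) ^ h ≤ (d : ℝ) ^ 3 := by
    have h4 : (2 : ℝ) ^ h ≤ 4 * d := by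
      exact_mod_cast (Nat.le_mul_of_pos_left (2 ^ h) hr).trans hup
    have h5 : (2 : ℝ) * 2 ≤ d * d := mul_le_mul hd2 hd2 (by norm_num) (by linarith)
    calc (2 : ℝ) ^ h ≤ 2 * 2 * d := by linarith
      _ ≤ d * d * d := by gcongr
      _ = d ^ 3 := by ring
  have h5 := Real.log_le_log (by positivity) h3
  rw [Real.log_pow, Real.log_pow] at h5
  have h6 : (1 : ℝ) / 2 ≤ Real.log 2 := by linarith [Real.log_two_gt_d9]
  push_cast at h5
  nlinarith [(Nat.cast_nonneg h : (0 : ℝ) ≤ h)]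

/-- If the product is computed on canonical forms with coefficients that are functions of the
inputs, it is computed by a program. -/
theorem exists_multipliesDiffOps {F : Type*} [Field F] {d r : ℕ} {c : ℝ}
    (h : let u : (Fin d × Fin r) ⊕ (Fin d × Fin r) → ((Fin d × Fin r) ⊕ (Fin d × Fin r) → F) → F :=
        fun i ξ => ξ i
      SLP.Computes (Set.range u) c {g | ∃ j < 2 * r, ∃ i,
        ((DiffOp.opMul (DiffOp.opPoly fun p => u (Sum.inl p))
          (DiffOp.opPoly fun p => u (Sum.inr p))).coeff j).coeff i = g}) :
    ∃ P : SLP.Program F ((Fin d × Fin r) ⊕ (Fin d × Fin r)) (Fin (2 * d) × Fin (2 * r)),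
      (P.cost : ℝ) ≤ c ∧ MultipliesDiffOps d r P := by
  extract_lets u at h
  set A := DiffOp.opPoly fun p => u (Sum.inl p)
  set B := DiffOp.opPoly fun p => u (Sum.inr p)
  have hmem := DiffOp.opMul_mem_degreeLT
    (DiffOp.opPoly_mem_degreeLT fun p => u (Sum.inl p))
    (DiffOp.opPoly_mem_degreeLT fun p => u (Sum.inr p))
  have hmem' := DiffOp.coeff_opMul_mem_degreeLT
    (DiffOp.coeff_opPoly_mem_degreeLT fun p => u (Sum.inl p))
    (DiffOp.coeff_opPoly_mem_degreeLT fun p => u (Sum.inr p))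
  obtain ⟨P, hP, hret⟩ := SLP.Computes.exists_program
    (y := fun p : Fin (2 * d) × Fin (2 * r) => ((DiffOp.opMul A B).coeff p.2).coeff p.1)
    (h.mono_target (by
      rintro _ ⟨p, rfl⟩
      exact SLP.mem_avail_of_mem ⟨p.2, p.2.2, p.1, rfl⟩))
  refine ⟨P, hP, fun a b => ⟨_, hret (Sum.elim a b), ?_⟩⟩
  rw [← DiffOp.ofPoly_opPoly, ← DiffOp.ofPoly_opPoly, ← DiffOp.ofPoly_opPoly, ← DiffOp.ofPoly_opMul]
  congr 1
  -- Evaluation at the input `(a, b)` is a ring homomorphism, hence commutes with `opMul`.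
  have e := congrArg (DiffOp.mapOp (Pi.evalRingHom (fun _ => F) (Sum.elim a b)))
    (DiffOp.opPoly_coeff hmem hmem')
  rw [DiffOp.mapOp_opMul, DiffOp.mapOp_opPoly, DiffOp.mapOp_opPoly, DiffOp.mapOp_opPoly] at e
  exact e

theorem theorem5 (F : Type*) [Field F] [CharZero F]
    (M : ℕ → ℝ) (hM : IsPolyMulTime F M)
    (hMmono : ∀ m n : ℕ, 1 ≤ m → m ≤ n → M m / (m : ℝ) ≤ M n / (n : ℝ))
    (ω : ℝ) (hω : IsFeasibleExponent F ω) :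
    ∃ C : ℝ, ∀ d r : ℕ, r < d →
      ∃ P : SLP.Program F ((Fin d × Fin r) ⊕ (Fin d × Fin r)) (Fin (2 * d) × Fin (2 * r)),
        (P.cost : ℝ) ≤ C * ((r : ℝ) ^ (ω - 1) * (d : ℝ) + (r : ℝ) * M d * Real.log (d : ℝ)) ∧
          MultipliesDiffOps d r P := by
  obtain ⟨hω2, -, c, hc⟩ := hω
  have hc0 : 0 ≤ c := by
    obtain ⟨P, hP, -⟩ := hc 1 le_rfl
    have := (Nat.cast_nonneg P.cost).trans hP
    simpa using this
  refine ⟨28 * (c * 5 ^ ω) + 240000, fun d r hrd => ?_⟩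
  have hd : 1 ≤ d := by omega
  have hdM := hM.le hMmono hd
  have hdpos : (0 : ℝ) < d := by exact_mod_cast hd
  have hM0 : 0 ≤ M d := hdpos.le.trans hdM
  rcases Nat.eq_zero_or_pos r with rfl | hr
  · -- Without coefficients there is nothing to compute.
    refine exists_multipliesDiffOps ?_
    intro u
    refine .of_subset ?_ ?_
    · have : (0 : ℝ) ≤ (0 : ℝ) ^ (ω - 1) := Real.zero_rpow_nonneg _
      simp only [Nat.cast_zero, zero_mul, add_zero]
      positivity
    · rintro _ ⟨j, hj, -⟩
      omega
  have hrpos : (0 : ℝ) < r := by exact_mod_cast hr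
  obtain ⟨h, h₁, h₂, h₃⟩ := exists_pow_two_between hr hrd
  refine exists_multipliesDiffOps ?_
  intro u
  obtain ⟨Q, hQ, hQmul⟩ := hc (5 * r) (by omega)
  have hin : ∀ e : Fin d × Fin r → (Fin d × Fin r) ⊕ (Fin d × Fin r), ∀ j i,
      ((DiffOp.opPoly fun p => u (e p)).coeff j).coeff i ∈ SLP.avail (Set.range u) := by
    intro e j i
    rw [DiffOp.coeff_coeff_opPoly]
    split_ifs
    · exact SLP.mem_avail_of_mem ⟨_, rfl⟩
    · exact SLP.zero_mem_avail _
  refine (SLP.computes_opMul hr h₁ (SLP.matMulCost_of_program hQmul)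
    (fun m hm hmle => hM.polyMulCost (d := d) hMmono hm (by omega))
    (DiffOp.opPoly_mem_degreeLT _) (DiffOp.opPoly_mem_degreeLT _)
    (DiffOp.coeff_opPoly_mem_degreeLT _) (DiffOp.coeff_opPoly_mem_degreeLT _)
    (hin _) (hin _)).mono_cost ?_
  have hlog : 0 ≤ Real.log d := Real.log_natCast_nonneg d
  have h₂' : (r : ℝ) * 2 ^ h ≤ 4 * d := by exact_mod_cast h₂
  have hpow : (r : ℝ) ^ ω = r ^ (ω - 1) * r := by
    rw [← Real.rpow_add_one hrpos.ne', sub_add_cancel]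
  have hmat : (2 : ℝ) ^ h * (7 * Q.cost) ≤ 28 * (c * 5 ^ ω) * (r ^ (ω - 1) * d) := by
    have hQ' : (Q.cost : ℝ) ≤ c * (5 ^ ω * (r ^ (ω - 1) * r)) := by
      rw [← hpow, ← Real.mul_rpow (by norm_num) hrpos.le]
      exact_mod_cast hQ
    calc (2 : ℝ) ^ h * (7 * Q.cost) ≤ 2 ^ h * (7 * (c * (5 ^ ω * (r ^ (ω - 1) * r)))) := by gcongr
      _ = 7 * (c * 5 ^ ω) * r ^ (ω - 1) * (r * 2 ^ h) := by ring
      _ ≤ 7 * (c * 5 ^ ω) * r ^ (ω - 1) * (4 * d) := by gcongr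
      _ = _ := by ring
  have hM1 : 1 ≤ M d / d := by rwa [le_div_iff₀ hdpos, one_mul]
  have hpol : 6 * (r : ℝ) * (h * (r * 2 ^ h) * (4 * (400 * (M d / d)) + 2)) ≤
      240000 * (r * M d * Real.log d) := by
    calc 6 * (r : ℝ) * (h * (r * 2 ^ h) * (4 * (400 * (M d / d)) + 2))
        ≤ 6 * r * (6 * Real.log d * (4 * d) * (4 * (400 * (M d / d)) + 2 * (M d / d))) := by
          gcongr
          linarith
      _ = 230688 * (r * M d * Real.log d) := by field_simp; ring
      _ ≤ _ := by
        have : 0 ≤ r * M d * Real.log d := by positivity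
        linarith
  have hX : 0 ≤ (r : ℝ) ^ (ω - 1) * d := by positivity
  have hY : 0 ≤ r * M d * Real.log d := by positivity
  have hZ : 0 ≤ c * (5 : ℝ) ^ ω := by positivity
  nlinarith [mul_nonneg hZ hY]
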